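/- **Setting.** Let $h>0$ and let $k,n\ge 1$ be integers. Let $C_n$ and $C^1_n$ be the Banach spaces of continuous, respectively continuously differentiable, maps $[-h,0]\to\mathbb R^n$ with norms $|\phi|_C=\max|\phi(t)|$ and $|\phi|=\max|\phi(t)|+\max|\phi'(t)|$; write $C=C_1$, $C^1=C^1_1$. Let $I$ be an open interval and $J$ a compact interval with $[-h,0]\subset I\subset J\subset[-2h,h]$. For $\phi\in C$ let $E\phi:J\to\mathbb R$ be the odd extension: $E\phi=\phi$ on $[-h,0]$, $E\phi(t)=2\phi(-h)-\phi(-t-2h)$ for $t\le -h$, $E\phi(t)=2\phi(0)-\phi(-t)$ for $t\ge 0$. For $(r,\phi)\in J^k\times C_n$ let $\widehat{(r,\phi)}\in\mathbb R^{kn}$ be the vector with components $E\phi_j(r_\kappa)$ at the index $\iota=(\kappa-1)n+j$, $1\le\kappa\le k$, $1\le j\le n$. Let $V\subset\mathbb R^{kn}$ be open and $g:V\to\mathbb R^n$ be $C^1$; let $F$ be a finite-dimensional real normed space and $W\subset F$ open; let $\delta:J^k\times W\to\mathbb R^k$ and $Q:J^k\times C_n\to F$ be continuous, with each $Q(r,\cdot)$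 linear and with $C^1$ restrictions to $I^k\times W$ and to $I^k\times C^1_n$, respectively. For each $j\in\{1,\dots,n\}$ let $Q_j(r,\phi)=Q(r,\phi\cdot e_j)$, $(r,\phi)\in J^k\times C$, where $\phi\cdot e_j\in C_n$ has $j$-th component $\phi$ and all other components $0$, and assume: the range $F_j$ of $Q_j(r,\cdot)$ is independent of $r\in J^k$, and either $F_j=0$ or there are $\beta_1,\dots,\beta_d\in C$, $d=\dim F_j$, such that for every $r\in J^k$ the vectors $Q_j(r,\beta_1),\dots,Q_j(r,\beta_d)$ form a basis of $F_j$. Consider the algebraic-delay system $$x'(t)=G(r(t),x_t),\qquad 0=\Delta(r(t),x_t),\qquad G(r,\phi)=g(\widehat{(r,\phi)}),\quad \Delta(r,\phi)=\delta(r,Q(r,\phi)),$$ on $\mathcal U=\{(r,\phi)\in I^k\times C^1_n:\widehat{(r,\phi)}\in V,\ Q(r,\phi)\in W\}$. Put $$h_g(v)=\frac{\min\{1,\operatorname{dist}(v,\mathbb R^{kn}\setminus V)\}}{6kn\,(1+\max_{\iota,j}|\partial_\iota g_j(v)|+\max_j|g_j(v)|)}\qquad(v\in V),$$ the numerator being replaced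 by $1$ if $V=\mathbb R^{kn}$. Call $C^1$ maps $\chi_{g,j}:I^k\times V\to C^1$, $j=1,\dots,n$, *admissible* if for all $j$, all $(r,v)\in I^k\times V$ and all $\nu\in\{1,\dots,kn\}$ $$Q_j(r,\chi_{g,j}(r,v))=0,\quad[\chi_{g,j}(r,v)]'(0)=1,\quad|\chi_{g,j}(r,v)|_C\le h_g(v),\quad|\partial_{v_\nu}\chi_{g,j}(r,v)|_C\le h_g(v).$$ Given admissible maps, let $\chi_g=(\chi_{g,1},\dots,\chi_{g,n})$, let $(c\odot\phi)_j=c_j\phi_j$ for $c\in\mathbb R^n$, $\phi\in C^1_n$, and define $$T(r,\phi)=(r,A(r,\phi)),\qquad A(r,\phi)=\phi-g(v)\odot\chi_g(r,v),\quad v=\widehat{(r,\phi)},\qquad (r,\phi)\in\mathcal U.$$ For $r\in I^k$ let $S_r:V\to\mathbb R^{kn}$, $S_r(v)=v-R(r,v)$, where $R(r,v)$ has the component $g_j(v)\,(E\chi_{g,j}(r,v))(r_\kappa)$ at the index $\iota=(\kappa-1)n+j$, and put $$\mathcal O=\{(r,\psi)\in I^k\times C^1_n:\ Q(r,\psi)\in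 W,\ \widehat{(r,\psi)}\in S_r(V)\},$$ $$Y(r,\psi)=(r,B(r,\psi)),\qquad B(r,\psi)=\psi+g(v)\odot\chi_g(r,v),\quad v=S_r^{-1}(\widehat{(r,\psi)}),\qquad (r,\psi)\in\mathcal O.$$ **Proposition 4.3.** Admissible maps $\chi_{g,1},\dots,\chi_{g,n}$ exist. For every choice of admissible maps, each $S_r$, $r\in I^k$, is injective (so that $Y$ is well defined), the sets $\mathcal U$ and $\mathcal O$ are open in $\mathbb R^k\times C^1_n$, the maps $T$ on $\mathcal U$ and $Y$ on $\mathcal O$ are continuously differentiable, and (i) for every $(r,\psi)\in\mathcal O$, $Q(Y(r,\psi))=Q(r,\psi)$; (ii) $T(\mathcal U)\subset\mathcal O$, and $Y(T(r,\phi))=(r,\phi)$ for every $(r,\phi)\in\mathcal U$; (iii) $Y(\mathcal O)\subset\mathcal U$, and $T(Y(r,\psi))=(r,\psi)$ for every $(r,\psi)\in\mathcal O$. Hence $T$ is a $C^1$ diffeomorphism of $\mathcal U$ onto the open set $\mathcal O\subset I^k\times C^1_n$, with inverse $Y$. -/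

import Mathlib

open Set Topology

namespace AlgDelay

noncomputable section

/-- Euclidean space `ℝⁿ`. -/
abbrev Rn (n : ℕ) : Type := EuclideanSpace ℝ (Fin n)

/-- Euclidean space `ℝ^{kn}`; its coordinates `ι = (κ - 1) n + j` are indexed by the
pairs `(κ, j)`. -/
abbrev Rkn (k n : ℕ) : Type := EuclideanSpace ℝ (Fin k × Fin n)

/-- The Banach space of continuous maps `[-h, 0] → E` with the maximum norm.
`C_n` is `C0 h (Rn n)` and `C` is `C0 h ℝ`. -/
abbrev C0 (h : ℝ) (E : Type*) [TopologicalSpace E] : Type _ := C(Icc (-h) (0 : ℝ), E)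

section Spaces

variable {h : ℝ} [Fact (0 < h)]

theorem neg_h_le : -h ≤ 0 := neg_nonpos.mpr (Fact.out : 0 < h).le

/-- The point `-h` of `[-h, 0]`. -/
def ptL : Icc (-h) (0 : ℝ) := ⟨-h, left_mem_Icc.mpr neg_h_le⟩

/-- The point `0` of `[-h, 0]`. -/
def ptR : Icc (-h) (0 : ℝ) := ⟨0, right_mem_Icc.mpr neg_h_le⟩

variable (h) in
/-- The pairs `(φ, φ')` of a continuously differentiable map `φ : [-h, 0] → E` and its
derivative (one-sided at the endpoints), as a subspace of the `ℓ¹`-sum `C ⊕ C`. -/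
def C1sub (E : Type*) [NormedAddCommGroup E] [NormedSpace ℝ E] :
    Submodule ℝ (WithLp 1 (C0 h E × C0 h E)) where
  carrier := {p | ∀ t : Icc (-h) (0 : ℝ),
    HasDerivWithinAt (IccExtend neg_h_le p.fst) (p.snd t) (Icc (-h) 0) t}
  zero_mem' := fun t => hasDerivWithinAt_const (t : ℝ) (Icc (-h) 0) (0 : E)
  add_mem' := fun {_ _} hp hq t => (hp t).add (hq t)
  smul_mem' := fun c _ hp t => (hp t).const_smul c

variable (h) in
/-- The space of continuously differentiable maps `φ : [-h, 0] → E` with the norm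
`|φ| = max |φ(t)| + max |φ'(t)|`, an element being stored as the pair `(φ, φ')`.
`C¹_n` is `C1 h (Rn n)` and `C¹` is `C1 h ℝ`. -/
abbrev C1 (E : Type*) [NormedAddCommGroup E] [NormedSpace ℝ E] : Type _ := C1sub h E

variable {E E' : Type*} [NormedAddCommGroup E] [NormedSpace ℝ E]
  [NormedAddCommGroup E'] [NormedSpace ℝ E']

/-- The inclusion of `C¹` into `C`. -/
def C1.toC0 (φ : C1 h E) : C0 h E := φ.1.fst

/-- The derivative `φ'` of `φ ∈ C¹`. -/
def C1.deriv (φ : C1 h E) : C0 h E := φ.1.snd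

theorem C1.norm_eq (φ : C1 h E) : ‖φ‖ = ‖φ.toC0‖ + ‖φ.deriv‖ :=
  WithLp.prod_norm_eq_of_L1 φ.1

/-- `t ↦ L (φ(t))` for `φ ∈ C` and a continuous linear map `L`. -/
def C0.map (L : E →L[ℝ] E') (φ : C0 h E) : C0 h E' := (L : C(E, E')).comp φ

/-- `t ↦ L (φ(t))` for `φ ∈ C¹` and a continuous linear map `L`. -/
def C1.map (L : E →L[ℝ] E') (φ : C1 h E) : C1 h E' :=
  ⟨WithLp.toLp 1 (C0.map L φ.toC0, C0.map L φ.deriv),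
    fun t => L.hasFDerivAt.comp_hasDerivWithinAt (t : ℝ) (φ.2 t)⟩

/-- The continuous linear map `x ↦ x e_j` from `ℝ` to `ℝⁿ`. -/
def unitMap {n : ℕ} (j : Fin n) : ℝ →L[ℝ] Rn n :=
  ContinuousLinearMap.toSpanSingleton ℝ (EuclideanSpace.single j (1 : ℝ))

/-- The `j`-th component `φ_j` of `φ ∈ C_n`. -/
def C0.comp {n : ℕ} (φ : C0 h (Rn n)) (j : Fin n) : C0 h ℝ :=
  C0.map (EuclideanSpace.proj j) φ

/-- The product `φ · e_j ∈ C_n` for `φ ∈ C`. -/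
def C0.mulUnit {n : ℕ} (φ : C0 h ℝ) (j : Fin n) : C0 h (Rn n) := C0.map (unitMap j) φ

/-- The element `(φ_1, …, φ_n)` of `C¹_n` with components `φ_j ∈ C¹`. -/
def C1.ofComps {n : ℕ} (φ : Fin n → C1 h ℝ) : C1 h (Rn n) := ∑ j, C1.map (unitMap j) (φ j)

/-- The linear map `x ↦ (c_1 x_1, …, c_n x_n)` of `ℝⁿ`. -/
def diagMap {n : ℕ} (c : Rn n) : Rn n →L[ℝ] Rn n :=
  ∑ j, c j • (unitMap j).comp (EuclideanSpace.proj j : Rn n →L[ℝ] ℝ)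

/-- The product `c ⊙ φ ∈ C¹_n`, whose components are `c_j φ_j`. -/
def odot {n : ℕ} (c : Rn n) (φ : C1 h (Rn n)) : C1 h (Rn n) := C1.map (diagMap c) φ

theorem diagMap_apply {n : ℕ} (c x : Rn n) (j : Fin n) : diagMap c x j = c j * x j := by
  simp [diagMap, unitMap, Finset.sum_apply, Pi.single_apply]

theorem odot_apply {n : ℕ} (c : Rn n) (φ : C1 h (Rn n)) (t : Icc (-h) (0 : ℝ)) (j : Fin n) :
    C1.toC0 (odot c φ) t j = c j * φ.toC0 t j :=
  diagMap_apply c (φ.toC0 t) j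

/-- The odd extension `Eφ` of `φ ∈ C`, as a function of a real variable; only its values
on `[-2h, h]` are meaningful. -/
def oddExt (φ : C0 h ℝ) (t : ℝ) : ℝ :=
  if t < -h then 2 * φ ptL - IccExtend neg_h_le φ (-t - 2 * h)
  else if t ≤ 0 then IccExtend neg_h_le φ t
  else 2 * φ ptR - IccExtend neg_h_le φ (-t)

/-- The vector `(r, φ)^ ∈ ℝ^{kn}` with the components `Eφ_j(r_κ)`. -/
def hat {k n : ℕ} (r : Rn k) (φ : C0 h (Rn n)) : Rkn k n :=
  WithLp.toLp 2 fun ι => oddExt (φ.comp ι.2) (r ι.1)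

end Spaces

/-- The cube `K^k` in `ℝ^k`. -/
def cube (k : ℕ) (K : Set ℝ) : Set (Rn k) := {r | ∀ κ, r κ ∈ K}

/-- Condition (Hq) on a map `q : Jᵏ × C → F` (with `Jk` the set `Jᵏ`): the range `F_q` of
`q(r, ·)` does not depend on `r`, and either `F_q = 0` or there are `β_1, …, β_d ∈ C`,
`d = dim F_q`, such that for every `r` the vectors `q(r, β_m)` are a basis of `F_q`. -/
def CondHq {h : ℝ} {k : ℕ} {F : Type*} [NormedAddCommGroup F] [NormedSpace ℝ F]
    (Jk : Set (Rn k)) (q : Rn k → C0 h ℝ → F) : Prop :=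
  ∃ Fq : Submodule ℝ F, (∀ r ∈ Jk, range (q r) = (Fq : Set F)) ∧
    (Fq = ⊥ ∨ ∃ β : Fin (Module.finrank ℝ Fq) → C0 h ℝ, ∀ r ∈ Jk,
      LinearIndependent ℝ (fun m => q r (β m)) ∧
      Submodule.span ℝ (range fun m => q r (β m)) = Fq)

/-- The data of the algebraic-delay system
`x'(t) = g((r(t), x_t)^)`, `0 = δ(r(t), Q(r(t), x_t))`, and the standing assumptions on them.
Maps given on a subset are represented by total functions, about which nothing is assumed
outside of that subset. -/
structure DelaySystem (h : ℝ) [Fact (0 < h)] (k n : ℕ)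
    (F : Type*) [NormedAddCommGroup F] [NormedSpace ℝ F] where
  /-- endpoints of the open interval `I = (aI, bI)` -/
  aI : ℝ
  bI : ℝ
  /-- endpoints of the compact interval `J = [aJ, bJ]` -/
  aJ : ℝ
  bJ : ℝ
  Icc_subset_I : Icc (-h) 0 ⊆ Ioo aI bI
  I_subset_J : Ioo aI bI ⊆ Icc aJ bJ
  J_subset : Icc aJ bJ ⊆ Icc (-2 * h) h
  V : Set (Rkn k n)
  isOpen_V : IsOpen V
  g : Rkn k n → Rn n
  contDiffOn_g : ContDiffOn ℝ 1 g V
  W : Set F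
  isOpen_W : IsOpen W
  Q : Rn k → C0 h (Rn n) → F
  continuousOn_Q : ContinuousOn (fun p : Rn k × C0 h (Rn n) => Q p.1 p.2)
    (cube k (Icc aJ bJ) ×ˢ univ)
  isLinearMap_Q : ∀ r ∈ cube k (Icc aJ bJ), IsLinearMap ℝ (Q r)
  contDiffOn_Q : ContDiffOn ℝ 1 (fun p : Rn k × C1 h (Rn n) => Q p.1 p.2.toC0)
    (cube k (Ioo aI bI) ×ˢ univ)
  condHq : ∀ j : Fin n,
    CondHq (cube k (Icc aJ bJ)) (fun r (φ : C0 h ℝ) => Q r (φ.mulUnit j))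
  δ : Rn k → F → Rn k
  continuousOn_δ : ContinuousOn (fun p : Rn k × F => δ p.1 p.2) (cube k (Icc aJ bJ) ×ˢ W)
  contDiffOn_δ : ContDiffOn ℝ 1 (fun p : Rn k × F => δ p.1 p.2) (cube k (Ioo aI bI) ×ˢ W)

namespace DelaySystem

variable {h : ℝ} [Fact (0 < h)] {k n : ℕ} {F : Type*} [NormedAddCommGroup F] [NormedSpace ℝ F]

/-- The open cube `I^k`. -/
def Ik (sys : DelaySystem h k n F) : Set (Rn k) := cube k (Ioo sys.aI sys.bI)

/-- The common domain `𝒰 ⊆ I^k × C¹_n` of `G` and `Δ`. -/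
def U (sys : DelaySystem h k n F) : Set (Rn k × C1 h (Rn n)) :=
  {p | p.1 ∈ sys.Ik ∧ hat p.1 p.2.toC0 ∈ sys.V ∧ sys.Q p.1 p.2.toC0 ∈ sys.W}

/-- `G(r, φ) = g((r, φ)^)`. -/
def G (sys : DelaySystem h k n F) (p : Rn k × C1 h (Rn n)) : Rn n :=
  sys.g (hat p.1 p.2.toC0)

/-- `Δ(r, φ) = δ(r, Q(r, φ))`. -/
def Δ (sys : DelaySystem h k n F) (p : Rn k × C1 h (Rn n)) : Rn k :=
  sys.δ p.1 (sys.Q p.1 p.2.toC0)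

open Classical in
/-- The function `h_g : V → (0, ∞)`, that is, `min {1, dist (v, ℝ^{kn} ∖ V)}`
(replaced by `1` if `V = ℝ^{kn}`) divided by
`6kn (1 + max_{ι,j} |∂_ι g_j(v)| + max_j |g_j(v)|)`. -/
def hg (sys : DelaySystem h k n F) (v : Rkn k n) : ℝ :=
  (if sys.V = univ then 1 else min 1 (Metric.infDist v sys.Vᶜ)) /
    (6 * (k * n) *
      (1 + (⨆ p : (Fin k × Fin n) × Fin n,
              |fderiv ℝ sys.g v (EuclideanSpace.single p.1 1) p.2|)
         + ⨆ j : Fin n, |sys.g v j|))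

/-- The requirements on the maps `χ_{g,j} : I^k × V → C¹`, `j = 1, …, n`, that enter the
construction of `T`. -/
structure IsAdmissible (sys : DelaySystem h k n F)
    (χ : Fin n → Rn k → Rkn k n → C1 h ℝ) : Prop where
  contDiffOn : ∀ j, ContDiffOn ℝ 1 (fun p : Rn k × Rkn k n => χ j p.1 p.2) (sys.Ik ×ˢ sys.V)
  Q_eq_zero : ∀ j, ∀ r ∈ sys.Ik, ∀ v ∈ sys.V, sys.Q r ((χ j r v).toC0.mulUnit j) = 0
  deriv_zero : ∀ j, ∀ r ∈ sys.Ik, ∀ v ∈ sys.V, (χ j r v).deriv ptR = 1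
  norm_le : ∀ j, ∀ r ∈ sys.Ik, ∀ v ∈ sys.V, ‖(χ j r v).toC0‖ ≤ sys.hg v
  norm_partial_le : ∀ j, ∀ r ∈ sys.Ik, ∀ v ∈ sys.V, ∀ ν : Fin k × Fin n,
    ‖(fderiv ℝ (fun w => χ j r w) v (EuclideanSpace.single ν 1)).toC0‖ ≤ sys.hg v

/-- `χ_g(r, v) = (χ_{g,1}(r, v), …, χ_{g,n}(r, v)) ∈ C¹_n`. -/
def chiG (χ : Fin n → Rn k → Rkn k n → C1 h ℝ) (r : Rn k) (v : Rkn k n) : C1 h (Rn n) :=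
  C1.ofComps fun j => χ j r v

/-- `A(r, φ) = φ - g(v) ⊙ χ_g(r, v)` with `v = (r, φ)^`. -/
def A (sys : DelaySystem h k n F) (χ : Fin n → Rn k → Rkn k n → C1 h ℝ)
    (p : Rn k × C1 h (Rn n)) : C1 h (Rn n) :=
  p.2 - odot (sys.g (hat p.1 p.2.toC0)) (chiG χ p.1 (hat p.1 p.2.toC0))

/-- `T(r, φ) = (r, A(r, φ))`. -/
def T (sys : DelaySystem h k n F) (χ : Fin n → Rn k → Rkn k n → C1 h ℝ)
    (p : Rn k × C1 h (Rn n)) : Rn k × C1 h (Rn n) :=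
  (p.1, sys.A χ p)

/-- `R(r, v) ∈ ℝ^{kn}` with the components `g_j(v) (E χ_{g,j}(r, v))(r_κ)`. -/
def R (sys : DelaySystem h k n F) (χ : Fin n → Rn k → Rkn k n → C1 h ℝ)
    (r : Rn k) (v : Rkn k n) : Rkn k n :=
  WithLp.toLp 2 fun ι => sys.g v ι.2 * oddExt (χ ι.2 r v).toC0 (r ι.1)

/-- `S_r(v) = S(r, v) = v - R(r, v)`. -/
def S (sys : DelaySystem h k n F) (χ : Fin n → Rn k → Rkn k n → C1 h ℝ)
    (r : Rn k) (v : Rkn k n) : Rkn k n :=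
  v - sys.R χ r v

/-- The set `𝒪` of all `(r, ψ) ∈ I^k × C¹_n` with `Q(r, ψ) ∈ W` and `(r, ψ)^ ∈ S_r(V)`. -/
def O (sys : DelaySystem h k n F) (χ : Fin n → Rn k → Rkn k n → C1 h ℝ) :
    Set (Rn k × C1 h (Rn n)) :=
  {p | p.1 ∈ sys.Ik ∧ sys.Q p.1 p.2.toC0 ∈ sys.W ∧ hat p.1 p.2.toC0 ∈ sys.S χ p.1 '' sys.V}

/-- `S_r⁻¹(y) ∈ V` for `y ∈ S_r(V)`. -/
def Sinv (sys : DelaySystem h k n F) (χ : Fin n → Rn k → Rkn k n → C1 h ℝ)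
    (r : Rn k) (y : Rkn k n) : Rkn k n :=
  Function.invFunOn (sys.S χ r) sys.V y

/-- `B(r, ψ) = ψ + g(v) ⊙ χ_g(r, v)` with `v = S_r⁻¹(y)`, `y = (r, ψ)^`. -/
def B (sys : DelaySystem h k n F) (χ : Fin n → Rn k → Rkn k n → C1 h ℝ)
    (p : Rn k × C1 h (Rn n)) : C1 h (Rn n) :=
  p.2 + odot (sys.g (sys.Sinv χ p.1 (hat p.1 p.2.toC0)))
    (chiG χ p.1 (sys.Sinv χ p.1 (hat p.1 p.2.toC0)))

/-- `Y(r, ψ) = (r, B(r, ψ))`. -/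
def Y (sys : DelaySystem h k n F) (χ : Fin n → Rn k → Rkn k n → C1 h ℝ)
    (p : Rn k × C1 h (Rn n)) : Rn k × C1 h (Rn n) :=
  (p.1, sys.B χ p)

end DelaySystem

end

end AlgDelay

namespace AlgDelay

set_option maxSynthPendingDepth 3
set_option linter.unusedSectionVars false

noncomputable section

/-! ### Linear structure of `C` and `C¹`, and smoothness of `odot` -/

section Basics

variable {h : ℝ} [Fact (0 < h)]
variable {E E' : Type*} [NormedAddCommGroup E] [NormedSpace ℝ E]
  [NormedAddCommGroup E'] [NormedSpace ℝ E']

/-! The transformation is controlled by a finite-dimensional map. The correction `g(v) ⊙ χ_g(r, v)`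
lies in the kernel of `Q(r, ·)`, so adding or subtracting it leaves the `Q`-value unchanged (`Q_A`,
`Q_B`). The odd extension is linear, so the correction changes the vector `hat` by exactly `R(r,
v)`; hence `hat` turns `A` into `S_r` (`hat_A`). Thus `φ` is recovered from `ψ = A(r, φ)` as soon as
`v` can be recovered from `S_r(v)`.

The function `hg` is tuned for this: it forces `R(r, ·)` to have derivative of norm at most `1/2`
and to be bounded by half the distance to the complement of `V`. The first bound gives injectivity
along segments in `V`; the second keeps the segment between two points with the same image inside
`V` (`injOn_sub_of_contraction`). The inverse function theorem for `(r, v) ↦ (r, S_r(v))` then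
yields an open image and a `C¹` inverse. Smoothness of `T` and `Y` rests on joint smoothness of `(r,
φ) ↦ hat r φ` on `C¹`, that is, on the odd extension of a `C¹` function being `C¹`.

Admissible maps come from the curve `ξ(l)(t) = t e^(lt)`, which has slope `1` at `0`, norm at most
`1/l` in `C`, and `l`-derivative `t² e^(lt)` of norm at most `2/l²`. For `l = 1/s(v)` these bounds
become `s` and, after the chain rule, `2|∂s|`, so a positive `C¹` function `s` with `s` and `|Ds|`
below a multiple of `hg` suffices (`exists_contDiff_pos_le`). A projection onto the kernel of
`Q_j(r, ·)` must not spoil the slope at `0`: by density and compactness of `J^k`, the functions in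
(Hq) can be replaced by `C¹` functions with zero slope at `0`, and Cramer's rule gives a projection
that is `C¹` in `r` and uniformly bounded in the norm of `C` (`CondHq.exists_kernel_projection`). -/

theorem C1.ext {φ ψ : C1 h E} (h0 : φ.toC0 = ψ.toC0) (h1 : φ.deriv = ψ.deriv) : φ = ψ := by
  apply Subtype.ext
  apply (WithLp.equiv 1 _).injective
  exact Prod.ext h0 h1

variable (h E) in
/-- `C1.toC0` as a continuous linear map. -/
def C1.toC0L : C1 h E →L[ℝ] C0 h E :=
  ((ContinuousLinearMap.fst ℝ (C0 h E) (C0 h E)).comp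
    (WithLp.prodContinuousLinearEquiv 1 ℝ (C0 h E) (C0 h E)).toContinuousLinearMap).comp
      (C1sub h E).subtypeL

variable (h E) in
/-- `C1.deriv` as a continuous linear map. -/
def C1.derivL : C1 h E →L[ℝ] C0 h E :=
  ((ContinuousLinearMap.snd ℝ (C0 h E) (C0 h E)).comp
    (WithLp.prodContinuousLinearEquiv 1 ℝ (C0 h E) (C0 h E)).toContinuousLinearMap).comp
      (C1sub h E).subtypeL

theorem C1.toC0L_apply (φ : C1 h E) : C1.toC0L h E φ = φ.toC0 := rfl

theorem C1.derivL_apply (φ : C1 h E) : C1.derivL h E φ = φ.deriv := rfl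

theorem C1.norm_deriv_le (φ : C1 h E) : ‖φ.deriv‖ ≤ ‖φ‖ := by
  rw [C1.norm_eq]; linarith [norm_nonneg φ.toC0]

theorem C0.norm_map_le (L : E →L[ℝ] E') (φ : C0 h E) : ‖C0.map L φ‖ ≤ ‖L‖ * ‖φ‖ := by
  refine (ContinuousMap.norm_le _ (by positivity)).2 fun t => ?_
  exact (L.le_opNorm _).trans (by gcongr; exact φ.norm_coe_le_norm t)

/-- Composition with a continuous linear map, as a continuous linear map on `C`. -/
def C0.mapL (L : E →L[ℝ] E') : C0 h E →L[ℝ] C0 h E' :=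
  LinearMap.mkContinuous
    { toFun := C0.map L
      map_add' := fun _ _ => ContinuousMap.ext fun _ => L.map_add _ _
      map_smul' := fun _ _ => ContinuousMap.ext fun _ => L.map_smul _ _ } ‖L‖
    (C0.norm_map_le L)

theorem C0.mapL_apply (L : E →L[ℝ] E') (φ : C0 h E) : C0.mapL L φ = C0.map L φ := rfl

theorem C1.norm_map_le (L : E →L[ℝ] E') (φ : C1 h E) : ‖C1.map L φ‖ ≤ ‖L‖ * ‖φ‖ := by
  rw [C1.norm_eq, C1.norm_eq, mul_add]
  exact add_le_add (C0.norm_map_le L φ.toC0) (C0.norm_map_le L φ.deriv)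

/-- Composition with a continuous linear map, as a continuous linear map on `C¹`. -/
def C1.mapL (L : E →L[ℝ] E') : C1 h E →L[ℝ] C1 h E' :=
  LinearMap.mkContinuous
    { toFun := C1.map L
      map_add' := fun _ _ => C1.ext (ContinuousMap.ext fun _ => L.map_add _ _)
        (ContinuousMap.ext fun _ => L.map_add _ _)
      map_smul' := fun _ _ => C1.ext (ContinuousMap.ext fun _ => L.map_smul _ _)
        (ContinuousMap.ext fun _ => L.map_smul _ _) } ‖L‖
    (C1.norm_map_le L)

theorem C1.mapL_apply (L : E →L[ℝ] E') (φ : C1 h E) : C1.mapL L φ = C1.map L φ := rfl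

theorem C1.map_sum_smul {ι : Type*} (s : Finset ι) (c : ι → ℝ) (L : ι → E →L[ℝ] E') (φ : C1 h E) :
    C1.map (∑ i ∈ s, c i • L i) φ = ∑ i ∈ s, c i • C1.map (L i) φ := by
  have key : ∀ (M : C1 h E' →L[ℝ] C0 h E') (N : C1 h E →L[ℝ] C0 h E)
      (_ : ∀ L : E →L[ℝ] E', M (C1.map L φ) = C0.map L (N φ)),
      M (C1.map (∑ i ∈ s, c i • L i) φ) = M (∑ i ∈ s, c i • C1.map (L i) φ) := by
    intro M N hMN
    simp only [map_sum, map_smul, hMN]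
    ext t
    simp [C0.map, ContinuousMap.sum_apply]
  exact C1.ext (key (C1.toC0L h E') (C1.toC0L h E) fun _ => rfl)
    (key (C1.derivL h E') (C1.derivL h E) fun _ => rfl)

/-- Displays `odot` as a finite sum of scalars times fixed continuous linear maps, from which joint
smoothness is immediate. -/
theorem odot_eq_sum {n : ℕ} (c : Rn n) (φ : C1 h (Rn n)) :
    odot c φ = ∑ j, c j •
      C1.mapL ((unitMap j).comp (EuclideanSpace.proj j : Rn n →L[ℝ] ℝ)) φ :=
  C1.map_sum_smul _ _ _ _

theorem contDiff_odot {n : ℕ} : ContDiff ℝ 1 fun p : Rn n × C1 h (Rn n) => odot p.1 p.2 := by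
  simp only [odot_eq_sum]
  refine ContDiff.sum fun j _ => ContDiff.fun_smul ?_ ?_
  · exact (EuclideanSpace.proj j : Rn n →L[ℝ] ℝ).contDiff.comp contDiff_fst
  · exact (ContinuousLinearMap.contDiff _).comp contDiff_snd

theorem unitMap_apply {n : ℕ} (i j : Fin n) (x : ℝ) :
    unitMap i x j = if j = i then x else 0 := by
  simp [unitMap]

theorem C1.toC0_ofComps_apply {n : ℕ} (χ : Fin n → C1 h ℝ) (t : Icc (-h) (0 : ℝ)) (j : Fin n) :
    (C1.ofComps χ).toC0 t j = (χ j).toC0 t := by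
  have : (C1.ofComps χ).toC0 = ∑ i, C0.map (unitMap i) (χ i).toC0 :=
    map_sum (C1.toC0L h (Rn n)) _ _
  rw [this, ContinuousMap.sum_apply]
  simp [C0.map, unitMap_apply]

/-- The components of `c ⊙ (χ_1, …, χ_n)` are the functions `c_j χ_j`. -/
theorem comp_odot_ofComps {n : ℕ} (c : Rn n) (χ : Fin n → C1 h ℝ) (j : Fin n) :
    C0.comp (odot c (C1.ofComps χ)).toC0 j = c j • (χ j).toC0 := by
  ext t
  change C1.toC0 (odot c (C1.ofComps χ)) t j = _
  rw [odot_apply, C1.toC0_ofComps_apply]; rfl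

theorem toC0_odot_ofComps {n : ℕ} (c : Rn n) (χ : Fin n → C1 h ℝ) :
    (odot c (C1.ofComps χ)).toC0 = ∑ j, c j • (χ j).toC0.mulUnit j := by
  ext t i
  rw [odot_apply, C1.toC0_ofComps_apply, ContinuousMap.sum_apply]
  simp [C0.mulUnit, C0.map, unitMap_apply]

end Basics

/-! ### Joint differentiability of parametrized functionals -/

section Uncurry

variable {X : Type*} [NormedAddCommGroup X] [NormedSpace ℝ X]

/-- A family of linear functionals that is pointwise differentiable and Lipschitz in the
parameter, with a jointly continuous derivative, is jointly continuously differentiable. -/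
theorem contDiffOn_uncurry_of_hasDerivAt (L : ℝ → X →L[ℝ] ℝ) (L' : X → ℝ → ℝ) {s : Set ℝ}
    (hs : IsOpen s) (hd : ∀ x, ∀ t ∈ s, HasDerivAt (fun t => L t x) (L' x t) t)
    (hb : ∀ x, ∀ t ∈ s, ∀ t' ∈ s, |L t' x - L t x| ≤ ‖x‖ * |t' - t|)
    (hc : Continuous fun p : X × ℝ => L' p.1 p.2) :
    ContDiffOn ℝ 1 (fun p : X × ℝ => L p.2 p.1) (univ ×ˢ s) := by
  let D : X × ℝ → (X × ℝ →L[ℝ] ℝ) := fun p =>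
    (L p.2).comp (ContinuousLinearMap.fst ℝ X ℝ) + L' p.1 p.2 • ContinuousLinearMap.snd ℝ X ℝ
  have hD : ∀ p ∈ (univ : Set X) ×ˢ s, HasFDerivAt (fun p : X × ℝ => L p.2 p.1) (D p) p := by
    intro p hp
    -- The remainder splits into the error of differentiating in `t` at the fixed vector `p.1`, and
    -- the change of the functional on the increment `q.1 - p.1`, which is a product of two small
    -- factors.
    have h1 : (fun q : X × ℝ => L q.2 p.1 - L p.2 p.1 - (q.2 - p.2) • L' p.1 p.2)
        =o[𝓝 p] fun q => q - p := by
      have := (hasDerivAt_iff_isLittleO.1 (hd p.1 p.2 hp.2)).comp_tendsto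
        (continuous_snd.tendsto p)
      refine this.trans_isBigO (Asymptotics.IsBigO.of_bound 1 (Filter.Eventually.of_forall ?_))
      intro q
      rw [one_mul]
      exact norm_snd_le (q - p)
    have h2 : (fun q : X × ℝ => L q.2 (q.1 - p.1) - L p.2 (q.1 - p.1))
        =o[𝓝 p] fun q => q - p := by
      have hO : (fun q : X × ℝ => L q.2 (q.1 - p.1) - L p.2 (q.1 - p.1))
          =O[𝓝 p] fun q => (q.2 - p.2) * ‖q - p‖ := by
        refine Asymptotics.IsBigO.of_bound 1 ?_
        filter_upwards [continuous_snd.continuousAt.preimage_mem_nhds (hs.mem_nhds hp.2)]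
          with q hq
        have a1 := hb (q.1 - p.1) p.2 hp.2 q.2 hq
        rw [one_mul, norm_mul, norm_norm, mul_comm]
        refine a1.trans ?_
        exact mul_le_mul_of_nonneg_right (norm_fst_le (q - p)) (abs_nonneg _)
      refine hO.trans_isLittleO ?_
      have hz : (fun q : X × ℝ => q.2 - p.2) =o[𝓝 p] fun _ => (1 : ℝ) := by
        rw [Asymptotics.isLittleO_one_iff]
        have : Continuous fun q : X × ℝ => q.2 - p.2 := by fun_prop
        simpa using this.tendsto p
      have := hz.mul_isBigO (Asymptotics.isBigO_refl (fun q : X × ℝ => ‖q - p‖) (𝓝 p))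
      simp only [one_mul] at this
      exact Asymptotics.isLittleO_norm_right.1 this
    rw [hasFDerivAt_iff_isLittleO]
    refine (h1.add h2).congr_left fun q => ?_
    simp [D]
    ring
  rw [show (1 : WithTop ℕ∞) = 0 + 1 from rfl,
    contDiffOn_succ_iff_fderiv_of_isOpen (isOpen_univ.prod hs)]
  refine ⟨fun p hp => (hD p hp).differentiableAt.differentiableWithinAt, by simp, ?_⟩
  rw [contDiffOn_zero]
  refine ContinuousOn.congr (f := D) ?_ fun p hp => (hD p hp).fderiv
  refine ContinuousOn.add ?_ (hc.smul continuous_const).continuousOn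
  -- The Lipschitz bound is uniform on the unit ball, so it gives continuity of `L` in operator
  -- norm.
  have : ContinuousOn L s := by
    refine LipschitzOnWith.continuousOn (K := 1) (LipschitzOnWith.of_dist_le_mul ?_)
    intro t ht t' ht'
    rw [dist_eq_norm, NNReal.coe_one, one_mul, Real.dist_eq]
    refine ContinuousLinearMap.opNorm_le_bound _ (abs_nonneg _) fun x => ?_
    rw [mul_comm]
    exact hb x t' ht' t ht
  have h3 : ContinuousOn (fun p : X × ℝ => L p.2) (univ ×ˢ s) :=
    this.comp continuousOn_snd fun p hp => hp.2
  exact h3.clm_comp continuousOn_const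

end Uncurry

/-! ### Smoothness of the odd extension -/

section OddExt

variable {h : ℝ} [Fact (0 < h)]

variable (h) in
/-- The piecewise linear folding `[-2h, h] → [-h, 0]` along which `(Eφ)' = φ' ∘ fold`. -/
def fold (t : ℝ) : ℝ := -abs (h - abs (t + h))

theorem continuous_fold : Continuous (fold h) := by unfold fold; fun_prop

theorem oddExt_add (φ ψ : C0 h ℝ) (t : ℝ) : oddExt (φ + ψ) t = oddExt φ t + oddExt ψ t := by
  simp only [oddExt, IccExtend, Function.comp_apply, ContinuousMap.add_apply]
  split_ifs <;> ring

theorem oddExt_smul (c : ℝ) (φ : C0 h ℝ) (t : ℝ) : oddExt (c • φ) t = c * oddExt φ t := by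
  simp only [oddExt, IccExtend, Function.comp_apply, ContinuousMap.smul_apply, smul_eq_mul]
  split_ifs <;> ring

/-- Outside `[-h, 0]` the value is twice an endpoint value minus another value, whence the `3`.
Together with the `1/2` of the contraction estimates this explains the `6` in `hg`. -/
theorem abs_oddExt_le (φ : C0 h ℝ) (t : ℝ) : |oddExt φ t| ≤ 3 * ‖φ‖ := by
  have hb : ∀ s, |φ s| ≤ ‖φ‖ := fun s => φ.norm_coe_le_norm s
  have key : ∀ s s', |2 * φ s - φ s'| ≤ 3 * ‖φ‖ := fun s s' => by
    have h1 := abs_le.1 (hb s); have h2 := abs_le.1 (hb s')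
    exact abs_le.2 ⟨by linarith, by linarith⟩
  simp only [oddExt, IccExtend, Function.comp_apply]
  split_ifs
  · exact key _ _
  · exact (hb _).trans (by linarith [norm_nonneg φ])
  · exact key _ _

/-- The odd extension at a fixed argument, as a continuous linear functional on `C`. -/
def oddExtL (t : ℝ) : C0 h ℝ →L[ℝ] ℝ :=
  LinearMap.mkContinuous
    { toFun := fun φ => oddExt φ t
      map_add' := fun φ ψ => oddExt_add φ ψ t
      map_smul' := fun c φ => oddExt_smul c φ t } 3 (fun φ => abs_oddExt_le φ t)

theorem oddExt_of_le (φ : C0 h ℝ) {t : ℝ} (ht : t ≤ -h) :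
    oddExt φ t = 2 * φ ptL - IccExtend neg_h_le φ (-t - 2 * h) := by
  have hh : 0 < h := Fact.out
  rcases ht.lt_or_eq with ht | rfl
  · simp [oddExt, ht]
  · have : IccExtend neg_h_le φ (-h) = φ ptL := IccExtend_left _ _
    have e : - -h - 2 * h = -h := by ring
    simp only [oddExt, e, lt_irrefl, if_false, neg_h_le, if_true, this]; ring

theorem oddExt_of_mem (φ : C0 h ℝ) {t : ℝ} (ht : t ∈ Icc (-h) 0) :
    oddExt φ t = IccExtend neg_h_le φ t := by
  simp [oddExt, not_lt.2 ht.1, ht.2]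

theorem oddExt_of_nonneg (φ : C0 h ℝ) {t : ℝ} (ht : 0 ≤ t) :
    oddExt φ t = 2 * φ ptR - IccExtend neg_h_le φ (-t) := by
  have hh : 0 < h := Fact.out
  rcases ht.lt_or_eq with ht | rfl
  · simp [oddExt, ht.not_ge, (show ¬ t < -h by linarith)]
  · have : IccExtend neg_h_le φ 0 = φ ptR := IccExtend_right _ _
    simp only [oddExt, neg_zero, this]
    rw [if_neg (by linarith), if_pos le_rfl]; ring

/-- The derivative of the odd extension of `φ ∈ C¹` on `[-2h, h]`. -/
theorem hasDerivWithinAt_oddExt (φ : C1 h ℝ) (t : ℝ) :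
    HasDerivWithinAt (oddExt φ.toC0) (IccExtend neg_h_le φ.deriv (fold h t))
      (Icc (-2 * h) h) t := by
  have hh : 0 < h := Fact.out
  have hφ : ∀ s ∈ Icc (-h) (0 : ℝ), HasDerivWithinAt (IccExtend neg_h_le φ.toC0)
      (IccExtend neg_h_le φ.deriv s) (Icc (-h) 0) s := fun s hs => by
    rw [IccExtend_of_mem _ _ hs]; exact φ.2 ⟨s, hs⟩
  -- The derivative is found on each of the three closed pieces and then glued. On a piece not
  -- containing `t` the claim is vacuous; at the joints `-h` and `0` the values of `fold` match,
  -- which is what oddness of the reflection provides.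
  have c1 : HasDerivWithinAt (oddExt φ.toC0) (IccExtend neg_h_le φ.deriv (fold h t))
      (Icc (-2 * h) (-h)) t := by
    by_cases hm : t ∈ Icc (-2 * h) (-h)
    · have hf : fold h t = -t - 2 * h := by
        rw [fold, abs_of_nonpos (by linarith [hm.2] : t + h ≤ 0),
          abs_of_nonneg (by linarith [hm.1])]; ring
      have hmaps : MapsTo (fun s : ℝ => -s - 2 * h) (Icc (-2 * h) (-h)) (Icc (-h) 0) :=
        fun s hs => ⟨by linarith [hs.2], by linarith [hs.1]⟩
      have d := (hφ _ (hmaps hm)).scomp t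
        (((hasDerivWithinAt_id t (Icc (-2 * h) (-h))).neg).sub_const (2 * h)) hmaps
      have d2 := d.const_sub (2 * φ.toC0 ptL)
      rw [hf]
      refine (d2.congr (fun s hs => oddExt_of_le _ hs.2) (oddExt_of_le _ hm.2)).congr_deriv ?_
      simp
    · exact HasFDerivWithinAt.of_notMem_closure (by rwa [isClosed_Icc.closure_eq])
  have c2 : HasDerivWithinAt (oddExt φ.toC0) (IccExtend neg_h_le φ.deriv (fold h t))
      (Icc (-h) 0) t := by
    by_cases hm : t ∈ Icc (-h) 0
    · have hf : fold h t = t := by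
        rw [fold, abs_of_nonneg (by linarith [hm.1] : 0 ≤ t + h),
          abs_of_nonneg (by linarith [hm.2])]; ring
      rw [hf]
      exact (hφ t hm).congr (fun s hs => oddExt_of_mem _ hs) (oddExt_of_mem _ hm)
    · exact HasFDerivWithinAt.of_notMem_closure (by rwa [isClosed_Icc.closure_eq])
  have c3 : HasDerivWithinAt (oddExt φ.toC0) (IccExtend neg_h_le φ.deriv (fold h t))
      (Icc 0 h) t := by
    by_cases hm : t ∈ Icc 0 h
    · have hf : fold h t = -t := by
        rw [fold, abs_of_nonneg (by linarith [hm.1] : 0 ≤ t + h),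
          abs_of_nonpos (by linarith [hm.1])]; ring
      have hmaps : MapsTo (fun s : ℝ => -s) (Icc 0 h) (Icc (-h) 0) :=
        fun s hs => ⟨by linarith [hs.2], by linarith [hs.1]⟩
      have d := (hφ _ (hmaps hm)).scomp t
        ((hasDerivWithinAt_id t (Icc 0 h)).neg) hmaps
      have d2 := d.const_sub (2 * φ.toC0 ptR)
      rw [hf]
      refine (d2.congr (fun s hs => oddExt_of_nonneg _ hs.1)
        (oddExt_of_nonneg _ hm.1)).congr_deriv ?_
      simp
    · exact HasFDerivWithinAt.of_notMem_closure (by rwa [isClosed_Icc.closure_eq])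
  have := (c1.union c2).union c3
  rwa [Icc_union_Icc_eq_Icc (by linarith) (by linarith),
    Icc_union_Icc_eq_Icc (by linarith) (by linarith)] at this

theorem abs_oddExt_sub_le (φ : C1 h ℝ) {s t : ℝ} (hs : s ∈ Icc (-2 * h) h)
    (ht : t ∈ Icc (-2 * h) h) :
    |oddExt φ.toC0 t - oddExt φ.toC0 s| ≤ ‖φ.deriv‖ * |t - s| :=
  (convex_Icc (-2 * h) h).norm_image_sub_le_of_norm_hasDerivWithin_le
    (fun x _ => hasDerivWithinAt_oddExt φ x) (fun _ _ => φ.deriv.norm_coe_le_norm _) hs ht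

theorem contDiffOn_oddExt :
    ContDiffOn ℝ 1 (fun q : C1 h ℝ × ℝ => oddExt q.1.toC0 q.2) (univ ×ˢ Ioo (-2 * h) h) := by
  refine contDiffOn_uncurry_of_hasDerivAt (X := C1 h ℝ) (fun t => (oddExtL t).comp (C1.toC0L h ℝ))
    (fun φ t => IccExtend neg_h_le φ.deriv (fold h t)) isOpen_Ioo ?_ ?_ ?_
  · exact fun φ t ht => (hasDerivWithinAt_oddExt φ t).hasDerivAt
      (Icc_mem_nhds ht.1 ht.2)
  · intro φ s hs t ht
    refine (abs_oddExt_sub_le φ (Ioo_subset_Icc_self hs) (Ioo_subset_Icc_self ht)).trans ?_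
    exact mul_le_mul_of_nonneg_right (C1.norm_deriv_le φ) (abs_nonneg _)
  · have h1 : Continuous fun p : C1 h ℝ × ℝ => C1.derivL h ℝ p.1 :=
      (C1.derivL h ℝ).continuous.comp continuous_fst
    have h2 : Continuous fun p : C1 h ℝ × ℝ => projIcc (-h) 0 neg_h_le (fold h p.2) :=
      continuous_projIcc.comp (continuous_fold.comp continuous_snd)
    exact h1.eval h2

end OddExt

/-! ### The evaluation vector `hat` -/

section Hat

variable {h : ℝ} [Fact (0 < h)] {k n : ℕ}

theorem hat_apply (r : Rn k) (φ : C0 h (Rn n)) (ι : Fin k × Fin n) :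
    hat r φ ι = oddExt (φ.comp ι.2) (r ι.1) := rfl

theorem hat_add (r : Rn k) (φ ψ : C0 h (Rn n)) : hat r (φ + ψ) = hat r φ + hat r ψ := by
  ext ι
  exact map_add ((oddExtL (r ι.1)).comp (C0.mapL (EuclideanSpace.proj ι.2))) φ ψ

theorem hat_sub (r : Rn k) (φ ψ : C0 h (Rn n)) : hat r (φ - ψ) = hat r φ - hat r ψ := by
  ext ι
  exact map_sub ((oddExtL (r ι.1)).comp (C0.mapL (EuclideanSpace.proj ι.2))) φ ψ

theorem contDiffOn_hat {K : Set ℝ} (hK : K ⊆ Ioo (-2 * h) h) :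
    ContDiffOn ℝ 1 (fun p : Rn k × C1 h (Rn n) => hat p.1 p.2.toC0) (cube k K ×ˢ univ) := by
  rw [contDiffOn_euclidean]
  intro ι
  have h1 : ContDiff ℝ 1 fun p : Rn k × C1 h (Rn n) =>
      (C1.mapL (EuclideanSpace.proj ι.2 : Rn n →L[ℝ] ℝ) p.2,
        (EuclideanSpace.proj ι.1 : Rn k →L[ℝ] ℝ) p.1) :=
    ((C1.mapL (EuclideanSpace.proj ι.2 : Rn n →L[ℝ] ℝ)).contDiff.comp contDiff_snd).prodMk
      ((EuclideanSpace.proj ι.1 : Rn k →L[ℝ] ℝ).contDiff.comp contDiff_fst)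
  exact contDiffOn_oddExt.comp h1.contDiffOn fun p hp => ⟨mem_univ _, hK (hp.1 ι.1)⟩

theorem isOpen_cube {K : Set ℝ} (hK : IsOpen K) : IsOpen (cube k K) := by
  simp only [cube, Set.ofPred_forall]
  exact isOpen_iInter_of_finite fun κ =>
    hK.preimage (EuclideanSpace.proj κ : Rn k →L[ℝ] ℝ).continuous

end Hat

/-! ### Inverse function theorem with parameters -/

section Inverse

variable {Z : Type*} [NormedAddCommGroup Z] [NormedSpace ℝ Z] [CompleteSpace Z]

/-- An injective `C¹` map on an open set whose derivatives are isomorphisms has an open image,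
and its inverse is `C¹`. -/
theorem isOpen_image_and_contDiffOn_leftInverse {Ω : Set Z} (hΩ : IsOpen Ω) {Φ : Z → Z}
    (hΦ : ContDiffOn ℝ 1 Φ Ω) (hder : ∀ p ∈ Ω, ∃ e : Z ≃L[ℝ] Z, HasFDerivAt Φ (e : Z →L[ℝ] Z) p)
    {Ψ : Z → Z} (hΨ : LeftInvOn Ψ Φ Ω) :
    IsOpen (Φ '' Ω) ∧ ContDiffOn ℝ 1 Ψ (Φ '' Ω) := by
  have key : ∀ p ∈ Ω, Φ '' Ω ∈ 𝓝 (Φ p) ∧ ContDiffAt ℝ 1 Ψ (Φ p) := by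
    intro p hp
    obtain ⟨e, he⟩ := hder p hp
    have hc : ContDiffAt ℝ 1 Φ p := hΦ.contDiffAt (hΩ.mem_nhds hp)
    have hs : HasStrictFDerivAt Φ (e : Z →L[ℝ] Z) p := hc.hasStrictFDerivAt' he one_ne_zero
    have hloc : ContDiffAt ℝ 1 (hs.localInverse Φ e p) (Φ p) := hc.to_localInverse he one_ne_zero
    have hr := hs.eventually_right_inverse
    have hm : ∀ᶠ y in 𝓝 (Φ p), hs.localInverse Φ e p y ∈ Ω :=
      hs.localInverse_tendsto.eventually (hΩ.mem_nhds hp)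
    refine ⟨?_, hloc.congr_of_eventuallyEq ?_⟩
    · filter_upwards [hr, hm] with y h1 h2 using ⟨_, h2, h1⟩
    -- The local inverse takes values in `Ω` near `Φ p`, where `Ψ` undoes `Φ`; so both agree there.
    · filter_upwards [hr, hm] with y h1 h2
      conv_lhs => rw [← h1]
      exact hΨ h2
  refine ⟨isOpen_iff_mem_nhds.2 ?_, ?_⟩
  · rintro _ ⟨p, hp, rfl⟩; exact (key p hp).1
  · rintro _ ⟨p, hp, rfl⟩; exact (key p hp).2.contDiffWithinAt

/-- A map `(r, v) ↦ (r, v - A (r, v))` of a finite-dimensional product is invertible if `A`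
contracts the second factor. -/
theorem exists_equiv_of_contraction {X Y : Type*} [NormedAddCommGroup X] [NormedSpace ℝ X]
    [FiniteDimensional ℝ X] [NormedAddCommGroup Y] [NormedSpace ℝ Y] [FiniteDimensional ℝ Y]
    (A : X × Y →L[ℝ] Y) (hA : ∀ y, ‖A (0, y)‖ ≤ 1 / 2 * ‖y‖) :
    ∃ e : (X × Y) ≃L[ℝ] (X × Y), (e : X × Y →L[ℝ] X × Y) =
      (ContinuousLinearMap.fst ℝ X Y).prod (ContinuousLinearMap.snd ℝ X Y - A) := by
  let L : X × Y →ₗ[ℝ] X × Y :=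
    ((ContinuousLinearMap.fst ℝ X Y).prod (ContinuousLinearMap.snd ℝ X Y - A)).toLinearMap
  have hL : Function.Injective L := by
    rw [injective_iff_map_eq_zero]
    rintro ⟨x, y⟩ hxy
    have h1 : x = 0 := congrArg Prod.fst hxy
    have h2 : y - A (x, y) = 0 := congrArg Prod.snd hxy
    subst h1
    have h3 := hA y
    rw [← sub_eq_zero.1 h2] at h3
    have : y = 0 := norm_le_zero_iff.1 (by linarith [norm_nonneg y])
    rw [this]; rfl
  exact ⟨(LinearEquiv.ofInjectiveEndo L hL).toContinuousLinearEquiv,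
    ContinuousLinearMap.ext fun p => rfl⟩

end Inverse

/-! ### Euclidean norms from entrywise bounds -/

section Euclidean

variable {ι : Type*} [Fintype ι]

theorem euclidean_norm_le {x : EuclideanSpace ℝ ι} {c : ℝ} (hc : 0 ≤ c) (hx : ∀ i, |x i| ≤ c) :
    ‖x‖ ≤ √(Fintype.card ι) * c := by
  rw [EuclideanSpace.norm_eq]
  refine Real.sqrt_le_iff.2 ⟨by positivity, ?_⟩
  rw [mul_pow, Real.sq_sqrt (by positivity), ← nsmul_eq_mul, ← Finset.card_univ]
  refine Finset.sum_le_card_nsmul _ _ _ fun i _ => ?_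
  exact pow_le_pow_left₀ (norm_nonneg _) (hx i) 2

theorem sum_abs_le_norm (x : EuclideanSpace ℝ ι) :
    ∑ i, |x i| ≤ √(Fintype.card ι) * ‖x‖ := by
  rw [EuclideanSpace.norm_eq, ← Real.sqrt_mul (by positivity)]
  refine Real.le_sqrt_of_sq_le ?_
  simpa using sq_sum_le_card_mul_sum_sq (s := Finset.univ) (f := fun i => |x i|)

/-- Passing from entries to the norm of the output, and from the norm of the input to the sum of its
entries, each costs the square root of the dimension. The product is the factor `kn` that `hg`
compensates. -/
theorem norm_apply_le_of_entries [DecidableEq ι]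
    (D : EuclideanSpace ℝ ι →L[ℝ] EuclideanSpace ℝ ι) {c : ℝ} (hc : 0 ≤ c)
    (hD : ∀ ν i, |D (EuclideanSpace.single ν 1) i| ≤ c) (x : EuclideanSpace ℝ ι) :
    ‖D x‖ ≤ Fintype.card ι * c * ‖x‖ := by
  have h1 : ∀ i, |D x i| ≤ c * (√(Fintype.card ι) * ‖x‖) := by
    intro i
    have hx : x = ∑ ν, x ν • EuclideanSpace.single ν (1 : ℝ) := by
      ext j; simp [Finset.sum_apply, Pi.single_apply]
    have h2 : D x i = ∑ ν, x ν * D (EuclideanSpace.single ν 1) i := by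
      conv_lhs => rw [hx]
      simp [map_sum, Finset.sum_apply]
    rw [h2]
    calc |∑ ν, x ν * D (EuclideanSpace.single ν 1) i|
        ≤ ∑ ν, |x ν| * c := by
          refine (Finset.abs_sum_le_sum_abs _ _).trans (Finset.sum_le_sum fun ν _ => ?_)
          rw [abs_mul]
          exact mul_le_mul_of_nonneg_left (hD ν i) (abs_nonneg _)
      _ = c * ∑ ν, |x ν| := by rw [← Finset.sum_mul, mul_comm]
      _ ≤ _ := mul_le_mul_of_nonneg_left (sum_abs_le_norm x) hc
  refine (euclidean_norm_le (by positivity) h1).trans_eq ?_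
  have : √(Fintype.card ι : ℝ) * √(Fintype.card ι) = Fintype.card ι :=
    Real.mul_self_sqrt (by positivity)
  linear_combination (c * ‖x‖) * this

end Euclidean

/-! ### Openness of the domain and properties of `hg` -/

namespace DelaySystem

variable {h : ℝ} [Fact (0 < h)] {k n : ℕ} {F : Type*} [NormedAddCommGroup F] [NormedSpace ℝ F]
  (sys : DelaySystem h k n F)

theorem isOpen_Ik : IsOpen sys.Ik := isOpen_cube isOpen_Ioo

theorem Ik_subset : sys.Ik ⊆ cube k (Icc sys.aJ sys.bJ) := fun _ hr κ => sys.I_subset_J (hr κ)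

theorem I_subset : Ioo sys.aI sys.bI ⊆ Ioo (-2 * h) h := by
  have := interior_maximal (sys.I_subset_J.trans sys.J_subset) isOpen_Ioo
  rwa [interior_Icc] at this

theorem contDiffOn_hat_Ik :
    ContDiffOn ℝ 1 (fun p : Rn k × C1 h (Rn n) => hat p.1 p.2.toC0) (sys.Ik ×ˢ univ) :=
  contDiffOn_hat sys.I_subset

theorem isOpen_Ik_prod : IsOpen (sys.Ik ×ˢ (univ : Set (C1 h (Rn n)))) :=
  sys.isOpen_Ik.prod isOpen_univ

theorem isOpen_U : IsOpen sys.U := by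
  have h1 := sys.contDiffOn_hat_Ik.continuousOn.isOpen_inter_preimage sys.isOpen_Ik_prod
    sys.isOpen_V
  have h2 := sys.contDiffOn_Q.continuousOn.isOpen_inter_preimage sys.isOpen_Ik_prod sys.isOpen_W
  refine (congrArg IsOpen (Set.ext fun p => ⟨?_, ?_⟩)).mpr (h1.inter h2)
  · exact fun ⟨a, b, c⟩ => ⟨⟨⟨a, trivial⟩, b⟩, ⟨a, trivial⟩, c⟩
  · exact fun ⟨⟨⟨a, _⟩, b⟩, _, c⟩ => ⟨a, b, c⟩

open Classical in
/-- The numerator in the definition of `h_g`. -/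
def hgNum (v : Rkn k n) : ℝ := if sys.V = univ then 1 else min 1 (Metric.infDist v sys.Vᶜ)

theorem hgNum_le_one (v : Rkn k n) : sys.hgNum v ≤ 1 := by
  unfold hgNum; split_ifs <;> simp

theorem hgNum_pos {v : Rkn k n} (hv : v ∈ sys.V) : 0 < sys.hgNum v := by
  unfold hgNum
  split_ifs with hV
  · exact one_pos
  · refine lt_min one_pos ((sys.isOpen_V.isClosed_compl.notMem_iff_infDist_pos ?_).1 ?_)
    · rwa [nonempty_compl]
    · simpa using hv

theorem hgNum_le_infDist (hV : sys.V ≠ univ) (v : Rkn k n) :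
    sys.hgNum v ≤ Metric.infDist v sys.Vᶜ := by
  unfold hgNum; rw [if_neg hV]; exact min_le_right _ _

/-- The denominator in the definition of `h_g`, up to the factor `6kn`. -/
def hgDen (v : Rkn k n) : ℝ :=
  1 + (⨆ p : (Fin k × Fin n) × Fin n,
      |fderiv ℝ sys.g v (EuclideanSpace.single p.1 1) p.2|) + ⨆ j : Fin n, |sys.g v j|

theorem hg_eq (v : Rkn k n) : sys.hg v = sys.hgNum v / (6 * (k * n) * sys.hgDen v) := rfl

theorem abs_fderiv_add_abs_le (v : Rkn k n) (ν : Fin k × Fin n) (j : Fin n) :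
    |fderiv ℝ sys.g v (EuclideanSpace.single ν 1) j| + |sys.g v j| ≤ sys.hgDen v - 1 := by
  have h1 : |fderiv ℝ sys.g v (EuclideanSpace.single ν 1) j| ≤ _ :=
    le_ciSup (f := fun p : (Fin k × Fin n) × Fin n =>
      |fderiv ℝ sys.g v (EuclideanSpace.single p.1 1) p.2|) (Finite.bddAbove_range _) (ν, j)
  have h2 : |sys.g v j| ≤ _ :=
    le_ciSup (f := fun j : Fin n => |sys.g v j|) (Finite.bddAbove_range _) j
  unfold hgDen; linarith

theorem one_le_hgDen (v : Rkn k n) : 1 ≤ sys.hgDen v := by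
  have h1 : 0 ≤ ⨆ p : (Fin k × Fin n) × Fin n,
      |fderiv ℝ sys.g v (EuclideanSpace.single p.1 1) p.2| :=
    Real.iSup_nonneg fun _ => abs_nonneg _
  have h2 : 0 ≤ ⨆ j : Fin n, |sys.g v j| := Real.iSup_nonneg fun _ => abs_nonneg _
  unfold hgDen; linarith

theorem hg_pos (hk : 1 ≤ k) (hn : 1 ≤ n) {v : Rkn k n} (hv : v ∈ sys.V) : 0 < sys.hg v := by
  have hk' : (0 : ℝ) < k := by exact_mod_cast hk
  have hn' : (0 : ℝ) < n := by exact_mod_cast hn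
  have := sys.one_le_hgDen v
  exact div_pos (sys.hgNum_pos hv) (by positivity)

/-- The bound for which `h_g` is designed. -/
theorem mul_hg_le (hk : 1 ≤ k) (hn : 1 ≤ n) {v : Rkn k n} (hv : v ∈ sys.V)
    (ν : Fin k × Fin n) (j : Fin n) :
    (|fderiv ℝ sys.g v (EuclideanSpace.single ν 1) j| + |sys.g v j|) * (3 * sys.hg v) ≤
      sys.hgNum v / (2 * (k * n)) := by
  have hk' : (0 : ℝ) < k := by exact_mod_cast hk
  have hn' : (0 : ℝ) < n := by exact_mod_cast hn
  have hd := sys.one_le_hgDen v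
  have hd' : 0 < sys.hgDen v := by linarith
  have h3 : 0 ≤ 3 * sys.hg v := by linarith [sys.hg_pos hk hn hv]
  calc _ ≤ sys.hgDen v * (3 * sys.hg v) :=
        mul_le_mul_of_nonneg_right (by linarith [sys.abs_fderiv_add_abs_le v ν j]) h3
    _ = _ := by rw [hg_eq]; field_simp; ring

end DelaySystem

/-- A map that is Lipschitz with constant `1 / 2` on convex parts of an open set `V`, and bounded
by half the distance to the complement of `V`, has no two points with equal displacement. -/
theorem injOn_sub_of_contraction {X : Type*} [NormedAddCommGroup X] [NormedSpace ℝ X]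
    {V : Set X} (hV : IsOpen V) {R : X → X} {D : X → X →L[ℝ] X}
    (hD : ∀ v ∈ V, HasFDerivAt R (D v) v) (hDn : ∀ v ∈ V, ‖D v‖ ≤ 1 / 2)
    (hR : V = univ ∨ ∀ v ∈ V, ‖R v‖ ≤ 1 / 2 * Metric.infDist v Vᶜ) :
    InjOn (fun v => v - R v) V := by
  have seg : ∀ v w, segment ℝ v w ⊆ V → v - R v = w - R w → v = w := by
    intro v w hs he
    have h1 := (convex_segment v w).norm_image_sub_le_of_norm_hasFDerivWithin_le
      (fun x hx => (hD x (hs hx)).hasFDerivWithinAt) (fun x hx => hDn x (hs hx))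
      (left_mem_segment ℝ v w) (right_mem_segment ℝ v w)
    have h2 : R w - R v = w - v := by
      rw [show R w - R v = (w - v) + ((v - R v) - (w - R w)) by abel, he, sub_self, add_zero]
    rw [h2] at h1
    have h3 : ‖w - v‖ ≤ 0 := by linarith [norm_nonneg (w - v)]
    exact (sub_eq_zero.1 (norm_le_zero_iff.1 h3)).symm
  rcases eq_or_ne V univ with hu | hu
  · intro v _ w _ he
    exact seg v w (by rw [hu]; exact subset_univ _) he
  replace hR := hR.resolve_left hu
  -- Distances are measured from the point farther from the complement: `‖w - v‖ = ‖R w - R v‖` is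
  -- at most the mean of the two distances, hence at most that of `v`, so the segment minus `w`
  -- stays in a ball around `v` inside `V`.
  have key : ∀ v ∈ V, ∀ w ∈ V, Metric.infDist w Vᶜ ≤ Metric.infDist v Vᶜ →
      v - R v = w - R w → v = w := by
    intro v hv w hw hle he
    refine seg v w ?_ he
    have hd : 0 < Metric.infDist v Vᶜ :=
      (hV.isClosed_compl.notMem_iff_infDist_pos (nonempty_compl.2 hu)).1 (by simpa using hv)
    have hvw : ‖w - v‖ ≤ Metric.infDist v Vᶜ := by
      have : w - v = R w - R v := by
        rw [show R w - R v = (w - v) + ((v - R v) - (w - R w)) by abel, he, sub_self, add_zero]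
      rw [this]
      linarith [norm_sub_le (R w) (R v), hR v hv, hR w hw]
    rintro _ ⟨a, b, ha, hb, hab, rfl⟩
    -- The endpoint `w` is in `V` by assumption; splitting it off gives `b < 1`, which makes the
    -- final inequalities contradictory.
    rcases ha.eq_or_lt with rfl | ha
    · rw [zero_add] at hab; simpa [hab] using hw
    by_contra hn
    have h1 := Metric.infDist_le_dist_of_mem (x := v) (mem_compl hn)
    have h2 : v - (a • v + b • w) = b • (v - w) := by
      rw [← eq_sub_iff_add_eq] at hab
      rw [hab]; module
    rw [dist_eq_norm, h2, norm_smul, Real.norm_of_nonneg hb, norm_sub_rev] at h1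
    have h3 : b * ‖w - v‖ ≤ b * Metric.infDist v Vᶜ := mul_le_mul_of_nonneg_left hvw hb
    nlinarith
  intro v hv w hw he
  rcases le_total (Metric.infDist w Vᶜ) (Metric.infDist v Vᶜ) with hle | hle
  · exact key v hv w hw hle he
  · exact (key w hw v hv hle he.symm).symm

/-! ### The maps `S_r`, `T` and `Y` for admissible `χ` -/

namespace DelaySystem

variable {h : ℝ} [Fact (0 < h)] {k n : ℕ} {F : Type*} [NormedAddCommGroup F] [NormedSpace ℝ F]
  (sys : DelaySystem h k n F) {χ : Fin n → Rn k → Rkn k n → C1 h ℝ}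

theorem R_apply (r : Rn k) (v : Rkn k n) (ι : Fin k × Fin n) :
    sys.R χ r v ι = sys.g v ι.2 * oddExt (χ ι.2 r v).toC0 (r ι.1) := rfl

/-- The link between the infinite-dimensional correction and the finite-dimensional `R`: the scalar
`g_j(v)` passes through the odd extension. -/
theorem hat_odot_chiG (r : Rn k) (v : Rkn k n) :
    hat r (odot (sys.g v) (chiG χ r v)).toC0 = sys.R χ r v := by
  ext ι
  rw [hat_apply, chiG, comp_odot_ofComps, oddExt_smul, R_apply]

variable {sys}

theorem IsAdmissible.norm_R_le (hχ : sys.IsAdmissible χ) (hk : 1 ≤ k) (hn : 1 ≤ n)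
    {r : Rn k} (hr : r ∈ sys.Ik) {v : Rkn k n} (hv : v ∈ sys.V) :
    ‖sys.R χ r v‖ ≤ 1 / 2 * sys.hgNum v := by
  have hk' : (1 : ℝ) ≤ k := by exact_mod_cast hk
  have hn' : (1 : ℝ) ≤ n := by exact_mod_cast hn
  have hm := sys.hgNum_pos hv
  have hc : ∀ ι, |sys.R χ r v ι| ≤ sys.hgNum v / (2 * (k * n)) := by
    intro ι
    refine le_trans ?_ (sys.mul_hg_le hk hn hv ι ι.2)
    rw [R_apply, abs_mul]
    have h1 := abs_oddExt_le (χ ι.2 r v).toC0 (r ι.1)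
    have h2 := hχ.norm_le ι.2 r hr v hv
    have h3 := sys.hg_pos hk hn hv
    exact mul_le_mul (le_add_of_nonneg_left (abs_nonneg _)) (by linarith) (abs_nonneg _)
      (by positivity)
  refine (euclidean_norm_le (by positivity) hc).trans ?_
  have h1 : (1 : ℝ) ≤ k * n := by nlinarith
  have h2 : √((k : ℝ) * n) ≤ k * n := by
    rw [Real.sqrt_le_left (by positivity)]; nlinarith
  rw [Fintype.card_prod, Fintype.card_fin, Fintype.card_fin, Nat.cast_mul]
  calc √((k : ℝ) * n) * (sys.hgNum v / (2 * (k * n)))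
      ≤ (k * n) * (sys.hgNum v / (2 * (k * n))) :=
        mul_le_mul_of_nonneg_right h2 (by positivity)
    _ = _ := by field_simp

theorem IsAdmissible.contDiffOn_odot (hχ : sys.IsAdmissible χ) {X : Type*} [NormedAddCommGroup X]
    [NormedSpace ℝ X] {s : Set X} {ρ : X → Rn k} {v : X → Rkn k n} (hρ : ContDiffOn ℝ 1 ρ s)
    (hv : ContDiffOn ℝ 1 v s) (hρs : MapsTo ρ s sys.Ik) (hvs : MapsTo v s sys.V) :
    ContDiffOn ℝ 1 (fun x => odot (sys.g (v x)) (chiG χ (ρ x) (v x))) s := by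
  have h1 : ContDiffOn ℝ 1 (fun x => sys.g (v x)) s := sys.contDiffOn_g.comp hv hvs
  have h2 : ContDiffOn ℝ 1 (fun x => chiG χ (ρ x) (v x)) s := by
    have h3 : ∀ j ∈ Finset.univ,
        ContDiffOn ℝ 1 (fun x => C1.mapL (unitMap j) (χ j (ρ x) (v x))) s := fun j _ => by
      have h4 : ContDiffOn ℝ 1 (fun x => χ j (ρ x) (v x)) s :=
        ContDiffOn.comp (f := fun x => (ρ x, v x)) (hχ.contDiffOn j) (hρ.prodMk hv)
          fun x hx => ⟨hρs hx, hvs hx⟩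
      exact ContDiff.comp_contDiffOn (f := fun x => χ j (ρ x) (v x))
        (C1.mapL (unitMap j)).contDiff h4
    exact ContDiffOn.sum h3
  exact ContDiff.comp_contDiffOn (f := fun x => (sys.g (v x), chiG χ (ρ x) (v x)))
    contDiff_odot (h1.prodMk h2)

theorem IsAdmissible.contDiffOn_R (hχ : sys.IsAdmissible χ) :
    ContDiffOn ℝ 1 (fun p : Rn k × Rkn k n => sys.R χ p.1 p.2) (sys.Ik ×ˢ sys.V) := by
  have h1 : ContDiffOn ℝ 1 (fun p : Rn k × Rkn k n =>
      (p.1, odot (sys.g p.2) (chiG χ p.1 p.2))) (sys.Ik ×ˢ sys.V) :=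
    contDiffOn_fst.prodMk (hχ.contDiffOn_odot contDiffOn_fst contDiffOn_snd
      (fun _ hp => hp.1) fun _ hp => hp.2)
  refine (sys.contDiffOn_hat_Ik.comp h1 fun p hp => ⟨hp.1, mem_univ _⟩).congr fun p _ => ?_
  exact (sys.hat_odot_chiG p.1 p.2).symm

theorem IsAdmissible.differentiableAt (hχ : sys.IsAdmissible χ) (j : Fin n) {r : Rn k}
    (hr : r ∈ sys.Ik) {v : Rkn k n} (hv : v ∈ sys.V) :
    DifferentiableAt ℝ (fun w => χ j r w) v := by
  have h1 : DifferentiableAt ℝ (fun p : Rn k × Rkn k n => χ j p.1 p.2) (r, v) :=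
    ((hχ.contDiffOn j).contDiffAt ((sys.isOpen_Ik.prod sys.isOpen_V).mem_nhds
      ⟨hr, hv⟩)).differentiableAt one_ne_zero
  exact DifferentiableAt.comp (f := fun w => (r, w)) v h1 (by fun_prop)

theorem IsAdmissible.norm_fderiv_R_le (hχ : sys.IsAdmissible χ) (hk : 1 ≤ k) (hn : 1 ≤ n)
    {r : Rn k} (hr : r ∈ sys.Ik) {v : Rkn k n} (hv : v ∈ sys.V) :
    DifferentiableAt ℝ (sys.R χ r) v ∧ ‖fderiv ℝ (sys.R χ r) v‖ ≤ 1 / 2 := by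
  have hk' : (1 : ℝ) ≤ k := by exact_mod_cast hk
  have hn' : (1 : ℝ) ≤ n := by exact_mod_cast hn
  have hd : DifferentiableAt ℝ (sys.R χ r) v := by
    have h1 : DifferentiableAt ℝ (fun p : Rn k × Rkn k n => sys.R χ p.1 p.2) (r, v) :=
      (hχ.contDiffOn_R.contDiffAt ((sys.isOpen_Ik.prod sys.isOpen_V).mem_nhds
        ⟨hr, hv⟩)).differentiableAt one_ne_zero
    exact DifferentiableAt.comp (f := fun w => (r, w)) v h1 (by fun_prop)
  refine ⟨hd, ContinuousLinearMap.opNorm_le_bound _ (by norm_num) fun x => ?_⟩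
  have hm := sys.hgNum_pos hv
  have hm1 := sys.hgNum_le_one v
  have hc : ∀ ν ι, |fderiv ℝ (sys.R χ r) v (EuclideanSpace.single ν 1) ι| ≤
      1 / (2 * (k * n)) := by
    intro ν ι
    have hg : HasFDerivAt (fun w => sys.g w ι.2)
        ((EuclideanSpace.proj ι.2 : Rn n →L[ℝ] ℝ).comp (fderiv ℝ sys.g v)) v :=
      (EuclideanSpace.proj ι.2 : Rn n →L[ℝ] ℝ).hasFDerivAt.comp v
        ((sys.contDiffOn_g.contDiffAt (sys.isOpen_V.mem_nhds hv)).differentiableAt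
          one_ne_zero).hasFDerivAt
    have hE : HasFDerivAt (fun w => oddExt (χ ι.2 r w).toC0 (r ι.1))
        (((oddExtL (r ι.1)).comp (C1.toC0L h ℝ)).comp (fderiv ℝ (fun w => χ ι.2 r w) v)) v :=
      ((oddExtL (r ι.1)).comp (C1.toC0L h ℝ)).hasFDerivAt.comp v
        (hχ.differentiableAt ι.2 hr hv).hasFDerivAt
    have hR : HasFDerivAt (fun w => sys.R χ r w ι)
        ((EuclideanSpace.proj ι : Rkn k n →L[ℝ] ℝ).comp (fderiv ℝ (sys.R χ r) v)) v :=
      (EuclideanSpace.proj ι : Rkn k n →L[ℝ] ℝ).hasFDerivAt.comp v hd.hasFDerivAt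
    have he := congrArg (fun L => L (EuclideanSpace.single ν 1)) (hR.unique (hg.mul hE))
    -- Product rule; the odd extension at the frozen argument `r ι.1` is linear, so it commutes with
    -- the derivative in `v`.
    have he' : fderiv ℝ (sys.R χ r) v (EuclideanSpace.single ν 1) ι =
        sys.g v ι.2 * oddExt (fderiv ℝ (fun w => χ ι.2 r w) v
          (EuclideanSpace.single ν 1)).toC0 (r ι.1) +
        oddExt (χ ι.2 r v).toC0 (r ι.1) *
          fderiv ℝ sys.g v (EuclideanSpace.single ν 1) ι.2 := he
    rw [he']
    have b1 := (abs_oddExt_le (fderiv ℝ (fun w => χ ι.2 r w) v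
      (EuclideanSpace.single ν 1)).toC0 (r ι.1)).trans
      (mul_le_mul_of_nonneg_left (hχ.norm_partial_le ι.2 r hr v hv ν) (by norm_num))
    have b2 := (abs_oddExt_le (χ ι.2 r v).toC0 (r ι.1)).trans
      (mul_le_mul_of_nonneg_left (hχ.norm_le ι.2 r hr v hv) (by norm_num))
    calc _ ≤ |sys.g v ι.2| * (3 * sys.hg v) +
          (3 * sys.hg v) * |fderiv ℝ sys.g v (EuclideanSpace.single ν 1) ι.2| := by
          refine (abs_add_le _ _).trans ?_
          rw [abs_mul, abs_mul]
          exact add_le_add (mul_le_mul_of_nonneg_left b1 (abs_nonneg _))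
            (mul_le_mul_of_nonneg_right b2 (abs_nonneg _))
      _ = (|fderiv ℝ sys.g v (EuclideanSpace.single ν 1) ι.2| + |sys.g v ι.2|) *
          (3 * sys.hg v) := by ring
      _ ≤ sys.hgNum v / (2 * (k * n)) := sys.mul_hg_le hk hn hv ν ι.2
      _ ≤ _ := by gcongr
  refine (norm_apply_le_of_entries _ (by positivity) hc x).trans_eq ?_
  rw [Fintype.card_prod, Fintype.card_fin, Fintype.card_fin, Nat.cast_mul]
  field_simp

theorem IsAdmissible.injOn_S (hχ : sys.IsAdmissible χ) (hk : 1 ≤ k) (hn : 1 ≤ n)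
    {r : Rn k} (hr : r ∈ sys.Ik) : InjOn (sys.S χ r) sys.V := by
  refine injOn_sub_of_contraction sys.isOpen_V
    (fun v hv => (hχ.norm_fderiv_R_le hk hn hr hv).1.hasFDerivAt)
    (fun v hv => (hχ.norm_fderiv_R_le hk hn hr hv).2) ?_
  refine or_iff_not_imp_left.2 fun hV v hv => (hχ.norm_R_le hk hn hr hv).trans ?_
  exact mul_le_mul_of_nonneg_left (sys.hgNum_le_infDist hV v) (by norm_num)

theorem IsAdmissible.Sinv_S (hχ : sys.IsAdmissible χ) (hk : 1 ≤ k) (hn : 1 ≤ n)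
    {r : Rn k} (hr : r ∈ sys.Ik) {v : Rkn k n} (hv : v ∈ sys.V) :
    sys.Sinv χ r (sys.S χ r v) = v :=
  (hχ.injOn_S hk hn hr).leftInvOn_invFunOn hv

/-- The map `(r, v) ↦ (r, S_r(v))` has an open image, and its inverse is `C¹`. -/
theorem IsAdmissible.isOpen_image_and_contDiffOn_Sinv (hχ : sys.IsAdmissible χ) (hk : 1 ≤ k)
    (hn : 1 ≤ n) :
    IsOpen ((fun p : Rn k × Rkn k n => (p.1, sys.S χ p.1 p.2)) '' (sys.Ik ×ˢ sys.V)) ∧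
    ContDiffOn ℝ 1 (fun p : Rn k × Rkn k n => (p.1, sys.Sinv χ p.1 p.2))
      ((fun p : Rn k × Rkn k n => (p.1, sys.S χ p.1 p.2)) '' (sys.Ik ×ˢ sys.V)) := by
  have ho := sys.isOpen_Ik.prod sys.isOpen_V
  refine isOpen_image_and_contDiffOn_leftInverse ho
    (contDiffOn_fst.prodMk (contDiffOn_snd.sub hχ.contDiffOn_R)) ?_ ?_
  · rintro ⟨r, v⟩ hp
    have hd : HasFDerivAt (fun p : Rn k × Rkn k n => sys.R χ p.1 p.2) _ (r, v) :=
      ((hχ.contDiffOn_R.contDiffAt (ho.mem_nhds hp)).differentiableAt one_ne_zero).hasFDerivAt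
    have hpart := hχ.norm_fderiv_R_le hk hn hp.1 hp.2
    -- The partial derivative in `v` is the full one restricted to vectors `(0, y)`, which is where
    -- the contraction bound is required.
    have he : HasFDerivAt (sys.R χ r) ((fderiv ℝ (fun p : Rn k × Rkn k n => sys.R χ p.1 p.2)
        (r, v)).comp (ContinuousLinearMap.inr ℝ (Rn k) (Rkn k n))) v :=
      HasFDerivAt.comp v hd (hasFDerivAt_prodMk_right r v)
    obtain ⟨e, he'⟩ := exists_equiv_of_contraction
      (fderiv ℝ (fun p : Rn k × Rkn k n => sys.R χ p.1 p.2) (r, v)) (fun y => by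
        have h1 := (fderiv ℝ (sys.R χ r) v).le_of_opNorm_le hpart.2 y
        rw [he.fderiv] at h1
        exact h1)
    refine ⟨e, ?_⟩
    rw [he']
    exact hasFDerivAt_fst.prodMk (hasFDerivAt_snd.sub hd)
  · rintro ⟨r, v⟩ hp
    exact Prod.ext rfl (hχ.Sinv_S hk hn hp.1 hp.2)

/-- Turns membership in the images `S_r(V)`, which vary with `r`, into a preimage of one open set,
so that openness of `O` follows from continuity. -/
theorem mem_O_iff {p : Rn k × C1 h (Rn n)} : p ∈ sys.O χ ↔
    (p.1 ∈ sys.Ik ∧ sys.Q p.1 p.2.toC0 ∈ sys.W) ∧ (p.1, hat p.1 p.2.toC0) ∈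
      (fun p : Rn k × Rkn k n => (p.1, sys.S χ p.1 p.2)) '' (sys.Ik ×ˢ sys.V) := by
  constructor
  · rintro ⟨h1, h2, v, hv, he⟩
    exact ⟨⟨h1, h2⟩, (p.1, v), ⟨h1, hv⟩, Prod.ext rfl he⟩
  · rintro ⟨⟨h1, h2⟩, ⟨r, v⟩, ⟨_, hv⟩, he⟩
    obtain rfl : r = p.1 := congrArg Prod.fst he
    exact ⟨h1, h2, v, hv, congrArg Prod.snd he⟩

theorem IsAdmissible.isOpen_O (hχ : sys.IsAdmissible χ) (hk : 1 ≤ k) (hn : 1 ≤ n) :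
    IsOpen (sys.O χ) := by
  have h1 := (contDiffOn_fst.prodMk
    sys.contDiffOn_hat_Ik).continuousOn.isOpen_inter_preimage sys.isOpen_Ik_prod
    (hχ.isOpen_image_and_contDiffOn_Sinv hk hn).1
  have h2 := sys.contDiffOn_Q.continuousOn.isOpen_inter_preimage sys.isOpen_Ik_prod sys.isOpen_W
  refine (congrArg IsOpen (Set.ext fun p => mem_O_iff.trans ⟨?_, ?_⟩)).mpr (h1.inter h2)
  · exact fun ⟨⟨a, b⟩, c⟩ => ⟨⟨⟨a, trivial⟩, c⟩, ⟨a, trivial⟩, b⟩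
  · exact fun ⟨⟨⟨a, _⟩, c⟩, _, b⟩ => ⟨⟨a, b⟩, c⟩

theorem IsAdmissible.contDiffOn_T (hχ : sys.IsAdmissible χ) :
    ContDiffOn ℝ 1 (sys.T χ) sys.U := by
  have hsub : sys.U ⊆ sys.Ik ×ˢ univ := fun p hp => ⟨hp.1, mem_univ _⟩
  exact contDiffOn_fst.prodMk (contDiffOn_snd.sub (hχ.contDiffOn_odot contDiffOn_fst
    (sys.contDiffOn_hat_Ik.mono hsub) (fun _ hp => hp.1) fun _ hp => hp.2.1))

theorem Sinv_mem {p : Rn k × C1 h (Rn n)}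
    (hp : p ∈ sys.O χ) : sys.Sinv χ p.1 (hat p.1 p.2.toC0) ∈ sys.V ∧
      sys.S χ p.1 (sys.Sinv χ p.1 (hat p.1 p.2.toC0)) = hat p.1 p.2.toC0 :=
  ⟨Function.invFunOn_mem hp.2.2, Function.invFunOn_eq hp.2.2⟩

theorem IsAdmissible.contDiffOn_Y (hχ : sys.IsAdmissible χ) (hk : 1 ≤ k) (hn : 1 ≤ n) :
    ContDiffOn ℝ 1 (sys.Y χ) (sys.O χ) := by
  have hsub : sys.O χ ⊆ sys.Ik ×ˢ univ := fun p hp => ⟨hp.1, mem_univ _⟩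
  have h1 : ContDiffOn ℝ 1 (fun p : Rn k × C1 h (Rn n) =>
      sys.Sinv χ p.1 (hat p.1 p.2.toC0)) (sys.O χ) :=
    ((hχ.isOpen_image_and_contDiffOn_Sinv hk hn).2.comp
      (contDiffOn_fst.prodMk (sys.contDiffOn_hat_Ik.mono hsub))
      fun p hp => (mem_O_iff.1 hp).2).snd
  exact contDiffOn_fst.prodMk (contDiffOn_snd.add (hχ.contDiffOn_odot contDiffOn_fst
    h1 (fun _ hp => hp.1) fun _ hp => (Sinv_mem hp).1))

theorem IsAdmissible.Q_odot (hχ : sys.IsAdmissible χ) {r : Rn k} (hr : r ∈ sys.Ik)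
    {v : Rkn k n} (hv : v ∈ sys.V) (c : Rn n) :
    sys.Q r (odot c (chiG χ r v)).toC0 = 0 := by
  have hl := sys.isLinearMap_Q r (sys.Ik_subset hr)
  rw [chiG, toC0_odot_ofComps]
  change hl.mk' (sys.Q r) _ = 0
  rw [map_sum]
  refine Finset.sum_eq_zero fun j _ => ?_
  rw [map_smul]
  change c j • sys.Q r _ = 0
  rw [hχ.Q_eq_zero j r hr v hv, smul_zero]

theorem IsAdmissible.Q_A (hχ : sys.IsAdmissible χ) {p : Rn k × C1 h (Rn n)} (hp : p ∈ sys.U) :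
    sys.Q p.1 (sys.A χ p).toC0 = sys.Q p.1 p.2.toC0 := by
  have hl := sys.isLinearMap_Q p.1 (sys.Ik_subset hp.1)
  refine (hl.map_sub p.2.toC0 (odot _ (chiG χ p.1 _)).toC0).trans ?_
  rw [hχ.Q_odot hp.1 hp.2.1, sub_zero]

theorem IsAdmissible.Q_B (hχ : sys.IsAdmissible χ) {p : Rn k × C1 h (Rn n)} (hp : p ∈ sys.O χ) :
    sys.Q p.1 (sys.B χ p).toC0 = sys.Q p.1 p.2.toC0 := by
  have hl := sys.isLinearMap_Q p.1 (sys.Ik_subset hp.1)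
  refine (hl.map_add p.2.toC0 (odot _ (chiG χ p.1 _)).toC0).trans ?_
  rw [hχ.Q_odot hp.1 (Sinv_mem hp).1, add_zero]

theorem hat_A (p : Rn k × C1 h (Rn n)) :
    hat p.1 (sys.A χ p).toC0 = sys.S χ p.1 (hat p.1 p.2.toC0) := by
  refine (hat_sub p.1 p.2.toC0 (odot _ (chiG χ p.1 _)).toC0).trans ?_
  rw [hat_odot_chiG]; rfl

theorem hat_B {p : Rn k × C1 h (Rn n)} (hp : p ∈ sys.O χ) :
    hat p.1 (sys.B χ p).toC0 = sys.Sinv χ p.1 (hat p.1 p.2.toC0) := by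
  refine (hat_add p.1 p.2.toC0 (odot _ (chiG χ p.1 _)).toC0).trans ?_
  rw [hat_odot_chiG]
  nth_rewrite 1 [← (Sinv_mem hp).2]
  rw [S, sub_add_cancel]

theorem IsAdmissible.mapsTo_T (hχ : sys.IsAdmissible χ) : MapsTo (sys.T χ) sys.U (sys.O χ) := by
  intro p hp
  refine ⟨hp.1, ?_, hat p.1 p.2.toC0, hp.2.1, (hat_A p).symm⟩
  exact (hχ.Q_A hp).symm ▸ hp.2.2

theorem IsAdmissible.mapsTo_Y (hχ : sys.IsAdmissible χ) : MapsTo (sys.Y χ) (sys.O χ) sys.U := by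
  intro p hp
  exact ⟨hp.1, (hat_B hp).symm ▸ (Sinv_mem hp).1, (hχ.Q_B hp).symm ▸ hp.2.1⟩

theorem IsAdmissible.Y_T (hχ : sys.IsAdmissible χ) (hk : 1 ≤ k) (hn : 1 ≤ n)
    {p : Rn k × C1 h (Rn n)} (hp : p ∈ sys.U) : sys.Y χ (sys.T χ p) = p := by
  refine Prod.ext rfl ?_
  have h1 : sys.Sinv χ p.1 (hat p.1 (sys.A χ p).toC0) = hat p.1 p.2.toC0 := by
    rw [hat_A, hχ.Sinv_S hk hn hp.1 hp.2.1]
  change sys.A χ p + odot (sys.g (sys.Sinv χ p.1 (hat p.1 (sys.A χ p).toC0)))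
    (chiG χ p.1 (sys.Sinv χ p.1 (hat p.1 (sys.A χ p).toC0))) = p.2
  rw [h1, A, sub_add_cancel]

/-- Any choice of preimage under `S_r` would do here; injectivity of `S_r` enters only in `Y_T`. -/
theorem T_Y {p : Rn k × C1 h (Rn n)} (hp : p ∈ sys.O χ) : sys.T χ (sys.Y χ p) = p := by
  refine Prod.ext rfl ?_
  change sys.B χ p - odot (sys.g (hat p.1 (sys.B χ p).toC0))
    (chiG χ p.1 (hat p.1 (sys.B χ p).toC0)) = p.2
  rw [hat_B hp, B, add_sub_cancel_right]

end DelaySystem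

/-! ### Small positive `C¹` functions -/

section SmoothMinorant

variable {E : Type*} [NormedAddCommGroup E] [NormedSpace ℝ E] [FiniteDimensional ℝ E]

/-- A positive continuous function on an open set has a positive `C¹` minorant whose derivative
is bounded by the given function, too. -/
theorem exists_contDiff_pos_le {V : Set E} (hV : IsOpen V) {H : E → ℝ} (hH : ContinuousOn H V)
    (hpos : ∀ v ∈ V, 0 < H v) :
    ∃ s : E → ℝ, ContDiff ℝ 1 s ∧ ∀ v ∈ V, 0 < s v ∧ s v ≤ H v ∧ ‖fderiv ℝ s v‖ ≤ H v := by
  have hloc : ∀ x : V, ∃ f : E → ℝ, ∃ C : ℝ, tsupport f ⊆ {y | y ∈ V ∧ H x / 2 < H y} ∧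
      ContDiff ℝ 1 f ∧ (∀ y, 0 ≤ f y ∧ f y ≤ 1) ∧ f x = 1 ∧ 0 ≤ C ∧ ∀ y, ‖fderiv ℝ f y‖ ≤ C := by
    intro x
    have hx := hpos x x.2
    have hn : {y | y ∈ V ∧ H x / 2 < H y} ∈ 𝓝 (x : E) :=
      (hV.mem_nhds x.2 |> fun h1 => Filter.inter_mem h1
        ((hH.continuousAt h1).eventually (lt_mem_nhds (by linarith))))
    obtain ⟨f, h1, h2, h3, h4, h5⟩ := exists_contDiff_tsupport_subset (n := 1) hn
    obtain ⟨C, hC⟩ := (h2.fderiv (𝕜 := ℝ)).exists_bound_of_continuous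
      (h3.continuous_fderiv one_ne_zero)
    refine ⟨f, C, h1, h3, fun y => h4 (mem_range_self y), h5, (norm_nonneg _).trans (hC x), hC⟩
  choose f C hsupp hf h01 hone hC0 hC using hloc
  -- By the Lindelöf property countably many bumps cover `V`, so summable positive weights exist.
  obtain ⟨t, htc, ht⟩ : ∃ t : Set V, t.Countable ∧ ∀ v ∈ V, ∃ x ∈ t, 0 < f x v := by
    obtain ⟨t, htc, ht⟩ := TopologicalSpace.countable_cover_nhds (α := V)
      (f := fun x => {y : V | 0 < f x y}) fun x => by
        have : Continuous fun y : V => f x y := (hf x).continuous.comp continuous_subtype_val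
        exact this.continuousAt.eventually (lt_mem_nhds (by simp only [hone]; exact one_pos))
    refine ⟨t, htc, fun v hv => ?_⟩
    have := ht.symm ▸ mem_univ (⟨v, hv⟩ : V)
    simpa using this
  have := htc.to_subtype
  obtain ⟨δ, hδ, c, hδc, hc1⟩ := NNReal.exists_pos_sum_of_countable one_ne_zero t
  have hδs : HasSum (fun x => (δ x : ℝ)) c := NNReal.hasSum_coe.2 hδc
  -- Dividing by `1 + C x` controls the bump and its derivative at once; the `1` in the minimum
  -- gives a summable majorant on all of `E`, and `H x / 2` lies below `H` on the support of the
  -- bump.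
  let a : t → ℝ := fun x => δ x * (min 1 (H x / 2) / (1 + C x))
  have hm : ∀ x : t, 0 < min 1 (H x / 2) := fun x => lt_min one_pos (by linarith [hpos x x.1.2])
  have ha : ∀ x, 0 < a x := fun x => by
    have := hC0 x; have := hm x; have : (0 : ℝ) < δ x := hδ x
    positivity
  have haC : ∀ x : t, ∀ b, 0 ≤ b → b ≤ 1 + C x → a x * b ≤ δ x * min 1 (H x / 2) := by
    intro x b hb0 hb
    have h0 := hC0 x
    have h1 : min 1 (H x / 2) / (1 + C x) * b ≤ min 1 (H x / 2) := by
      rw [div_mul_eq_mul_div, div_le_iff₀ (by linarith)]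
      exact mul_le_mul_of_nonneg_left hb (hm x).le
    rw [mul_assoc]
    exact mul_le_mul_of_nonneg_left h1 (δ x).2
  let u : t → E → ℝ := fun x y => a x * f x y
  let u' : t → E → E →L[ℝ] ℝ := fun x y => a x • fderiv ℝ (f x) y
  have hu : ∀ x y, HasFDerivAt (u x) (u' x y) y := fun x y =>
    (((hf x).differentiable one_ne_zero) y).hasFDerivAt.const_mul (a x)
  have hu0 : ∀ x y, 0 ≤ u x y := fun x y => mul_nonneg (ha x).le (h01 x y).1
  have hub : ∀ x y, u x y ≤ δ x * min 1 (H x / 2) := fun x y =>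
    haC x _ (h01 x y).1 (by linarith [(h01 x y).2, hC0 x])
  have hub' : ∀ x y, ‖u' x y‖ ≤ δ x * min 1 (H x / 2) := fun x y => by
    rw [norm_smul, Real.norm_of_nonneg (ha x).le]
    exact haC x _ (norm_nonneg _) (by linarith [hC x y])
  have hmin : ∀ x : t, δ x * min 1 (H x / 2) ≤ δ x := fun x =>
    mul_le_of_le_one_right (δ x).2 (min_le_left _ _)
  have hin : ∀ (x : t) v, v ∈ tsupport (f x) → δ x * min 1 (H x / 2) ≤ δ x * H v := fun x v hv =>
    mul_le_mul_of_nonneg_left ((min_le_right _ _).trans (hsupp x hv).2.le) (δ x).2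
  have hsum : ∀ y, Summable fun x => u x y := fun y =>
    Summable.of_nonneg_of_le (fun x => hu0 x y) (fun x => (hub x y).trans (hmin x)) hδs.summable
  have hder : ∀ y, HasFDerivAt (fun y => ∑' x, u x y) (∑' x, u' x y) y := fun y =>
    -- Convergence is needed at one point only; `0` is an arbitrary choice and need not lie in `V`.
    hasFDerivAt_tsum hδs.summable hu (fun x y => (hub' x y).trans (hmin x)) (hsum 0) y
  refine ⟨fun y => ∑' x, u x y, ?_, ?_⟩
  · rw [contDiff_one_iff_fderiv]
    refine ⟨fun y => (hder y).differentiableAt, ?_⟩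
    rw [show fderiv ℝ (fun y => ∑' x, u x y) = fun y => ∑' x, u' x y from
      funext fun y => (hder y).fderiv]
    refine continuous_tsum (fun x => ?_) hδs.summable fun x y => (hub' x y).trans (hmin x)
    exact ((hf x).continuous_fderiv one_ne_zero).const_smul (a x)
  · intro v hv
    have hHv := hpos v hv
    have hle : ∑' x, (δ x : ℝ) * H v ≤ H v := by
      rw [tsum_mul_right, hδs.tsum_eq]
      exact mul_le_of_le_one_left hHv.le hc1.le
    have hsH : Summable fun x => (δ x : ℝ) * H v := hδs.summable.mul_right _
    refine ⟨?_, ?_, ?_⟩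
    · obtain ⟨x, hx, hxv⟩ := ht v hv
      exact (hsum v).tsum_pos (fun x => hu0 x v) ⟨x, hx⟩ (mul_pos (ha ⟨x, hx⟩) hxv)
    · refine le_trans ((hsum v).tsum_le_tsum (fun x => ?_) hsH) hle
      by_cases hx : v ∈ tsupport (f x)
      · exact (hub x v).trans (hin x v hx)
      · have : u x v = 0 := by simp only [u, image_eq_zero_of_notMem_tsupport hx, mul_zero]
        rw [this]; exact mul_nonneg (δ x).2 hHv.le
    · rw [(hder v).fderiv]
      refine le_trans (tsum_of_norm_bounded hsH.hasSum fun x => ?_) hle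
      by_cases hx : v ∈ tsupport (f x)
      · exact (hub' x v).trans (hin x v hx)
      · have : u' x v = 0 := by simp only [u', fderiv_of_notMem_tsupport ℝ hx, smul_zero]
        rw [this, norm_zero]; exact mul_nonneg (δ x).2 hHv.le

end SmoothMinorant

/-! ### The curve `l ↦ t e^(lt)` in `C¹` -/

section ExpCurve

variable {h : ℝ} [Fact (0 < h)]

theorem C1.hasDerivAt {E : Type*} [NormedAddCommGroup E] [NormedSpace ℝ E] {f : ℝ → C1 h E}
    {f' : C1 h E} {x : ℝ} (h0 : HasDerivAt (fun y => (f y).toC0) f'.toC0 x)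
    (h1 : HasDerivAt (fun y => (f y).deriv) f'.deriv x) : HasDerivAt f f' x := by
  refine hasDerivAt_iff_isLittleO.2 (Asymptotics.IsLittleO.of_norm_left ?_)
  refine ((hasDerivAt_iff_isLittleO.1 h0).norm_left.add
    (hasDerivAt_iff_isLittleO.1 h1).norm_left).congr_left fun y => ?_
  exact (C1.norm_eq (f y - f x - (y - x) • f')).symm

/-- The function `t ↦ t ^ m e ^ (l t)` as an element of `C`. -/
def expPow (m : ℕ) (l : ℝ) : C0 h ℝ := ⟨fun t => (t : ℝ) ^ m * Real.exp (l * t), by fun_prop⟩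

theorem expPow_apply (m : ℕ) (l : ℝ) (t : Icc (-h) (0 : ℝ)) :
    expPow m l t = (t : ℝ) ^ m * Real.exp (l * t) := rfl

/-- In the Banach algebra `C` the curve is `i ^ m * exp (l • i)` with `i` the identity function, so
the derivative is that of the abstract exponential. -/
theorem hasDerivAt_expPow (m : ℕ) (l : ℝ) :
    HasDerivAt (expPow (h := h) m) (expPow (m + 1) l) l := by
  let i : C0 h ℝ := ⟨fun t => t, continuous_subtype_val⟩
  have he : ∀ u : ℝ, ∀ t, NormedSpace.exp (u • i) t = Real.exp (u * t) := by
    intro u t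
    have := NormedSpace.map_exp (ContinuousMap.evalAlgHom ℝ ℝ t)
      (continuous_eval_const t) (u • i)
    rw [Real.exp_eq_exp_ℝ]
    exact this
  have h1 : HasDerivAt (fun u : ℝ => i ^ m * NormedSpace.exp (u • i))
      (i ^ m * (NormedSpace.exp (l • i) * i)) l := (hasDerivAt_exp_smul_const i l).const_mul _
  have e1 : expPow (h := h) m = fun u : ℝ => i ^ m * NormedSpace.exp (u • i) := by
    ext u t
    rw [ContinuousMap.mul_apply, he, ContinuousMap.pow_apply]; rfl
  have e2 : expPow (h := h) (m + 1) l = i ^ m * (NormedSpace.exp (l • i) * i) := by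
    ext t
    rw [ContinuousMap.mul_apply, ContinuousMap.mul_apply, he, ContinuousMap.pow_apply,
      expPow_apply, pow_succ, mul_assoc, mul_comm (t : ℝ)]; rfl
  rw [e1, e2]; exact h1

/-- The function `t ↦ t ^ m e ^ (l t)` as an element of `C¹`. -/
def expPow1 (m : ℕ) (l : ℝ) : C1 h ℝ :=
  ⟨WithLp.toLp 1 (expPow m l, (m : ℝ) • expPow (m - 1) l + l • expPow m l), fun t => by
    have h1 : HasDerivAt (fun x : ℝ => x ^ m * Real.exp (l * x))
        (((m : ℝ) • expPow (m - 1) l + l • expPow m l : C0 h ℝ) t) t := by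
      have h2 := (hasDerivAt_pow m (t : ℝ)).mul (((hasDerivAt_id (t : ℝ)).const_mul l).exp)
      refine h2.congr_deriv ?_
      simp only [ContinuousMap.add_apply, ContinuousMap.smul_apply, expPow_apply, smul_eq_mul, id]
      ring
    refine h1.hasDerivWithinAt.congr_of_mem (fun x hx => ?_) t.2
    exact IccExtend_of_mem neg_h_le _ hx⟩

theorem expPow1_toC0 (m : ℕ) (l : ℝ) : (expPow1 (h := h) m l).toC0 = expPow m l := rfl

theorem expPow1_deriv (m : ℕ) (l : ℝ) :
    (expPow1 (h := h) m l).deriv = (m : ℝ) • expPow (m - 1) l + l • expPow m l := rfl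

theorem hasDerivAt_expPow1 (m : ℕ) (l : ℝ) :
    HasDerivAt (expPow1 (h := h) m) (expPow1 (m + 1) l) l := by
  refine C1.hasDerivAt (hasDerivAt_expPow m l) ?_
  simp only [expPow1_deriv]
  have h1 := ((hasDerivAt_expPow (h := h) (m - 1) l).const_smul (m : ℝ)).add
    ((hasDerivAt_id l).smul (hasDerivAt_expPow (h := h) m l))
  refine h1.congr_deriv ?_
  ext t
  -- At `m = 0` the truncated `m - 1` is harmless, since its coefficient vanishes.
  rcases m with _ | m
  · simp [expPow_apply]; ring
  · simp [expPow_apply]; ring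

theorem contDiff_expPow1 (m : ℕ) : ContDiff ℝ 1 (expPow1 (h := h) m) := by
  rw [contDiff_one_iff_deriv]
  refine ⟨fun l => (hasDerivAt_expPow1 m l).differentiableAt, ?_⟩
  rw [show deriv (expPow1 (h := h) m) = expPow1 (m + 1) from
    funext fun l => (hasDerivAt_expPow1 m l).deriv]
  exact continuous_iff_continuousAt.2 fun l => (hasDerivAt_expPow1 (m + 1) l).continuousAt

theorem expPow1_one_deriv_ptR (l : ℝ) : (expPow1 (h := h) 1 l).deriv ptR = 1 := by
  simp [expPow1_deriv, expPow_apply, ptR]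

theorem norm_expPow_one_le {l : ℝ} (hl : 0 < l) : ‖expPow (h := h) 1 l‖ ≤ l⁻¹ := by
  refine (ContinuousMap.norm_le _ (by positivity)).2 fun t => ?_
  have ht := t.2.2
  rw [expPow_apply, Real.norm_eq_abs, abs_mul, Real.abs_exp, pow_one, abs_of_nonpos ht,
    inv_eq_one_div, le_div_iff₀ hl]
  have h1 := Real.add_one_le_exp (-(l * t))
  have h2 : Real.exp (l * t) * Real.exp (-(l * t)) = 1 := by rw [← Real.exp_add]; simp
  nlinarith [Real.exp_pos (l * t)]

/-- With `u = -lt ≥ 0` this is `u² / 2 ≤ e^u`. -/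
theorem norm_expPow_two_le {l : ℝ} (hl : 0 < l) : ‖expPow (h := h) 2 l‖ ≤ 2 * l⁻¹ ^ 2 := by
  refine (ContinuousMap.norm_le _ (by positivity)).2 fun t => ?_
  have ht := t.2.2
  rw [expPow_apply, Real.norm_eq_abs, abs_mul, Real.abs_exp, abs_of_nonneg (sq_nonneg _),
    inv_pow, ← div_eq_mul_inv, le_div_iff₀ (by positivity)]
  have h1 := Real.quadratic_le_exp_of_nonneg (x := -(l * t)) (by nlinarith)
  have h2 : Real.exp (l * t) * Real.exp (-(l * t)) = 1 := by rw [← Real.exp_add]; simp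
  have h3 : Real.exp (l * t) * (1 + -(l * t) + (-(l * t)) ^ 2 / 2) ≤ 1 :=
    (mul_le_mul_of_nonneg_left h1 (Real.exp_pos _).le).trans_eq h2
  have h4 : 0 ≤ Real.exp (l * t) * (1 + -(l * t)) :=
    mul_nonneg (Real.exp_pos _).le (by nlinarith)
  nlinarith

end ExpCurve

/-! ### Density of functions with zero slope at `0` -/

section Density

variable {h : ℝ} [Fact (0 < h)]

variable (h) in
/-- The continuously differentiable functions whose derivative at `0` vanishes, as a subalgebra
of `C`. -/
def flatAtZero : Subalgebra ℝ (C0 h ℝ) where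
  carrier := {φ | ∃ ψ : C1 h ℝ, ψ.toC0 = φ ∧ ψ.deriv ptR = 0}
  add_mem' := by
    rintro _ _ ⟨ψ, rfl, hψ⟩ ⟨ψ', rfl, hψ'⟩
    refine ⟨ψ + ψ', rfl, ?_⟩
    change ψ.deriv ptR + ψ'.deriv ptR = 0
    rw [hψ, hψ', add_zero]
  mul_mem' := by
    rintro _ _ ⟨ψ, rfl, hψ⟩ ⟨ψ', rfl, hψ'⟩
    refine ⟨⟨WithLp.toLp 1 (ψ.toC0 * ψ'.toC0, ψ.deriv * ψ'.toC0 + ψ.toC0 * ψ'.deriv),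
      fun t => ?_⟩, rfl, ?_⟩
    · refine ((ψ.2 t).mul (ψ'.2 t)).congr_deriv ?_
      rw [IccExtend_val, IccExtend_val]; rfl
    · change ψ.deriv ptR * ψ'.toC0 ptR + ψ.toC0 ptR * ψ'.deriv ptR = 0
      rw [hψ, hψ', zero_mul, mul_zero, add_zero]
  algebraMap_mem' := by
    intro c
    refine ⟨⟨WithLp.toLp 1 (algebraMap ℝ (C0 h ℝ) c, 0), fun t => ?_⟩, rfl, rfl⟩
    exact hasDerivWithinAt_const (t : ℝ) (Icc (-h) 0) c

/-- Stone–Weierstrass: `t²` has zero slope at `0` and is injective on `[-h, 0]`, so it alone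
separates points. -/
theorem dense_flatAtZero : Dense (flatAtZero h : Set (C0 h ℝ)) := by
  have hsep : (flatAtZero h).SeparatesPoints := by
    intro s t hst
    refine ⟨expPow 2 0, ⟨expPow 2 0, ⟨expPow1 2 0, rfl, ?_⟩, rfl⟩, ?_⟩
    · simp [expPow1_deriv, expPow_apply, ptR]
    · intro he
      simp only [expPow_apply, zero_mul, Real.exp_zero, mul_one] at he
      have h1 := s.2.2
      have h2 := t.2.2
      have h3 : -(s : ℝ) = -(t : ℝ) :=
        (pow_left_inj₀ (by linarith) (by linarith) two_ne_zero).1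
          (by linarith [neg_sq (s : ℝ), neg_sq (t : ℝ)])
      exact hst (Subtype.ext (neg_injective h3))
  have := ContinuousMap.subalgebra_topologicalClosure_eq_top_of_separatesPoints _ hsep
  rw [dense_iff_closure_eq, ← Subalgebra.topologicalClosure_coe, this]; rfl

end Density

/-! ### Determinants, uniform bounds and coordinates -/

section Determinant

theorem ContDiffOn.matrix_det {X : Type*} [NormedAddCommGroup X] [NormedSpace ℝ X] {d : ℕ}
    {s : Set X} {M : X → Matrix (Fin d) (Fin d) ℝ}
    (hM : ∀ i j, ContDiffOn ℝ 1 (fun x => M x i j) s) :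
    ContDiffOn ℝ 1 (fun x => (M x).det) s := by
  simp only [Matrix.det_apply]
  refine ContDiffOn.sum fun σ _ => ?_
  simp only [Units.smul_def, zsmul_eq_mul]
  exact contDiffOn_const.mul (contDiffOn_prod fun i _ => hM _ _)

/-- A family of linear maps depending continuously on a parameter in a compact space is uniformly
bounded. -/
theorem exists_bound_of_compact {X E E' : Type*} [TopologicalSpace X] [CompactSpace X]
    [NormedAddCommGroup E] [NormedSpace ℝ E] [NormedAddCommGroup E'] [NormedSpace ℝ E']
    (f : X → E →ₗ[ℝ] E') (hf : Continuous fun p : X × E => f p.1 p.2) :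
    ∃ K : ℝ, 0 ≤ K ∧ ∀ x y, ‖f x y‖ ≤ K * ‖y‖ := by
  have h1 : ∀ᶠ y in 𝓝 (0 : E), ∀ x ∈ (univ : Set X), ‖f x y‖ < 1 := by
    refine isCompact_univ.eventually_forall_of_forall_eventually fun x _ => ?_
    have h2 : Continuous fun z : E × X => ‖f z.2 z.1‖ :=
      (hf.comp (continuous_snd.prodMk continuous_fst)).norm
    exact h2.continuousAt.eventually (gt_mem_nhds (by simp))
  obtain ⟨ε, hε, hball⟩ := Metric.eventually_nhds_iff.1 h1
  refine ⟨2 / ε, by positivity, fun x y => ?_⟩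
  rcases eq_or_ne y 0 with rfl | hy
  · simp
  have hy' : 0 < ‖y‖ := norm_pos_iff.2 hy
  have h3 := hball (y := (ε / (2 * ‖y‖)) • y) (by
    rw [dist_zero_right, norm_smul, Real.norm_of_nonneg (by positivity)]
    field_simp; norm_num) x (mem_univ x)
  rw [map_smul, norm_smul, Real.norm_of_nonneg (by positivity), div_mul_eq_mul_div,
    div_lt_one (by positivity)] at h3
  rw [div_mul_eq_mul_div, le_div_iff₀ hε]
  linarith

/-- Coordinates on a subspace, extended to the whole space. -/
theorem exists_coordinates {F : Type*} [NormedAddCommGroup F] [NormedSpace ℝ F]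
    [FiniteDimensional ℝ F] (S : Submodule ℝ F) :
    ∃ P : F →L[ℝ] (Fin (Module.finrank ℝ S) → ℝ), ∀ x ∈ S, P x = 0 → x = 0 := by
  obtain ⟨p, hp⟩ := LinearMap.exists_leftInverse_of_injective S.subtype S.ker_subtype
  refine ⟨LinearMap.toContinuousLinearMap
    ((Module.finBasis ℝ S).equivFun.toLinearMap.comp p), fun x hx h0 => ?_⟩
  have h1 : p x = ⟨x, hx⟩ := LinearMap.congr_fun hp ⟨x, hx⟩
  have h2 : (Module.finBasis ℝ S).equivFun (p x) = 0 := h0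
  rw [LinearEquiv.map_eq_zero_iff, h1] at h2
  exact congrArg Subtype.val h2

end Determinant

/-! ### Projections onto the kernels of `q(r, ·)` -/

section KernelProjection

variable {h : ℝ} [Fact (0 < h)] {k : ℕ} {F : Type*} [NormedAddCommGroup F] [NormedSpace ℝ F]
  [FiniteDimensional ℝ F]

/-- Condition (Hq) can be realized by continuously differentiable functions whose derivative at
`0` vanishes. -/
theorem CondHq.exists_flat_basis {Jk : Set (Rn k)} (hJ : IsCompact Jk) {q : Rn k → C0 h ℝ → F}
    (hq : ContinuousOn (fun p : Rn k × C0 h ℝ => q p.1 p.2) (Jk ×ˢ univ)) (hH : CondHq Jk q) :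
    ∃ (d : ℕ) (P : F →L[ℝ] (Fin d → ℝ)) (b : Fin d → C1 h ℝ), (∀ m, (b m).deriv ptR = 0) ∧
      ∀ r ∈ Jk, (∀ φ, P (q r φ) = 0 → q r φ = 0) ∧
        (Matrix.of fun i m => P (q r (b m).toC0) i).det ≠ 0 := by
  obtain ⟨S, hS, hβ⟩ := hH
  obtain ⟨P, hP⟩ := exists_coordinates S
  have hmem : ∀ r ∈ Jk, ∀ φ, q r φ ∈ S := fun r hr φ => by
    rw [← SetLike.mem_coe, ← hS r hr]; exact mem_range_self φ
  obtain ⟨β, hβ⟩ : ∃ β : Fin (Module.finrank ℝ S) → C0 h ℝ, ∀ r ∈ Jk,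
      LinearIndependent ℝ (fun m => q r (β m)) := by
    rcases hβ with rfl | ⟨β, hβ⟩
    · rw [finrank_bot]
      exact ⟨fun _ => 0, fun r _ => linearIndependent_empty_type⟩
    · exact ⟨β, fun r hr => (hβ r hr).1⟩
  have hdet : ∀ r ∈ Jk, (Matrix.of fun i m => P (q r (β m)) i).det ≠ 0 := by
    intro r hr
    have h1 : LinearIndependent ℝ fun m => P (q r (β m)) := by
      refine (hβ r hr).map_injOn P.toLinearMap fun x hx y hy hxy => ?_
      have hle : Submodule.span ℝ (range fun m => q r (β m)) ≤ S :=
        Submodule.span_le.2 (range_subset_iff.2 fun m => hmem r hr _)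
      refine sub_eq_zero.1 (hP _ (S.sub_mem (hle hx) (hle hy)) ?_)
      rw [map_sub]; exact sub_eq_zero.2 hxy
    have h2 : IsUnit (Matrix.of fun i m => P (q r (β m)) i) :=
      Matrix.linearIndependent_cols_iff_isUnit.1 h1
    exact ((Matrix.isUnit_iff_isUnit_det _).1 h2).ne_zero
  have : CompactSpace Jk := isCompact_iff_compactSpace.1 hJ
  have hcont : Continuous fun z : (Fin (Module.finrank ℝ S) → C0 h ℝ) × Jk =>
      (Matrix.of fun i m => P (q z.2 (z.1 m)) i).det := by
    refine Continuous.matrix_det (continuous_matrix fun i m => ?_)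
    have h1 : Continuous fun z : (Fin (Module.finrank ℝ S) → C0 h ℝ) × Jk =>
        ((z.2 : Rn k), z.1 m) :=
      (continuous_subtype_val.comp continuous_snd).prodMk
        ((continuous_apply m).comp continuous_fst)
    have h2 := hq.comp_continuous h1 fun z => ⟨z.2.2, mem_univ _⟩
    exact (continuous_apply i).comp (P.continuous.comp h2)
  -- A nonzero determinant is an open condition, and compactness of `Jk` makes the neighbourhood of
  -- `β` uniform in `r`; density then supplies flat functions in it.
  have hev : ∀ᶠ b in 𝓝 β, ∀ r ∈ (univ : Set Jk),
      (Matrix.of fun i m => P (q r (b m)) i).det ≠ 0 :=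
    isCompact_univ.eventually_forall_of_forall_eventually fun r _ =>
      hcont.continuousAt.eventually_ne (hdet r r.2)
  have hdense : Dense (univ.pi fun _ : Fin (Module.finrank ℝ S) =>
      (flatAtZero h : Set (C0 h ℝ))) := dense_pi _ fun _ _ => dense_flatAtZero
  obtain ⟨b, hb, hbd⟩ := hdense.inter_nhds_nonempty hev
  choose ψ hψ hψ0 using fun m => hb m (mem_univ m)
  refine ⟨_, P, ψ, hψ0, fun r hr => ⟨fun φ h0 => hP _ (hmem r hr φ) h0, ?_⟩⟩
  simp only [hψ]
  exact hbd ⟨r, hr⟩ (mem_univ _)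

/-- Condition (Hq) yields projections of `C¹` into the kernels of the maps `q(r, ·)`, which are
continuously differentiable in `r`, preserve the derivative at `0`, and are uniformly bounded
with respect to the norm of `C`. -/
theorem CondHq.exists_kernel_projection {Ik Jk : Set (Rn k)} (hJ : IsCompact Jk) (hI : Ik ⊆ Jk)
    {q : Rn k → C0 h ℝ → F}
    (hq : ContinuousOn (fun p : Rn k × C0 h ℝ => q p.1 p.2) (Jk ×ˢ univ))
    (hlin : ∀ r ∈ Jk, IsLinearMap ℝ (q r))
    (hd : ContDiffOn ℝ 1 (fun p : Rn k × C1 h ℝ => q p.1 p.2.toC0) (Ik ×ˢ univ))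
    (hH : CondHq Jk q) :
    ∃ (p : Rn k → C1 h ℝ → C1 h ℝ) (K : ℝ), 0 ≤ K ∧
      ContDiffOn ℝ 1 (fun z : Rn k × C1 h ℝ => p z.1 z.2) (Ik ×ˢ univ) ∧
      ∀ r ∈ Ik, IsLinearMap ℝ (p r) ∧ ∀ φ, q r (p r φ).toC0 = 0 ∧
        (p r φ).deriv ptR = φ.deriv ptR ∧ ‖(p r φ).toC0‖ ≤ K * ‖φ.toC0‖ := by
  obtain ⟨d, P, b, hb0, hb⟩ := hH.exists_flat_basis hJ hq
  let M : Rn k → Matrix (Fin d) (Fin d) ℝ := fun r => Matrix.of fun i m => P (q r (b m).toC0) i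
  -- Cramer's rule for the coefficients of `q r φ` in the basis: quotients of determinants inherit
  -- continuity and `C¹` dependence from `q`.
  let c : Rn k → C0 h ℝ → Fin d → ℝ := fun r φ m =>
    (M r).det⁻¹ * ((M r).updateCol m (P (q r φ))).det
  have hc : ∀ r φ, c r φ = (M r).det⁻¹ • (M r).cramer (P (q r φ)) := fun r φ => by
    ext m; simp [c, Matrix.cramer_apply]
  have hclin : ∀ r ∈ Jk, IsLinearMap ℝ (c r) := fun r hr => by
    constructor
    · intro φ ψ; simp only [hc, (hlin r hr).map_add, map_add, smul_add]
    · intro a φ; simp only [hc, (hlin r hr).map_smul, map_smul, smul_comm a]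
  have hcq : ∀ r ∈ Jk, ∀ φ, ∑ m, c r φ m • P (q r (b m).toC0) = P (q r φ) := by
    intro r hr φ
    have h1 : (M r).mulVec (c r φ) = P (q r φ) := by
      rw [hc, Matrix.mulVec_smul, Matrix.mulVec_cramer, smul_smul,
        inv_mul_cancel₀ (hb r hr).2, one_smul]
    rw [← h1]
    ext i
    simp [Matrix.mulVec, dotProduct, M, Finset.sum_apply, mul_comm]
  have : CompactSpace Jk := isCompact_iff_compactSpace.1 hJ
  -- The correction is regarded on `C` and over the compact `Jk`, not over `Ik`, to obtain one bound
  -- `K` in the norm of `C`.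
  let cor : Jk → C0 h ℝ →ₗ[ℝ] C0 h ℝ := fun r =>
    ∑ m, ((LinearMap.proj m).comp ((hclin r r.2).mk' (c r))).smulRight (b m).toC0
  have hcor : ∀ r φ, cor r φ = ∑ m, c r φ m • (b m).toC0 := fun r φ => by
    simp [cor, LinearMap.sum_apply]
  have hcorc : Continuous fun z : Jk × C0 h ℝ => cor z.1 z.2 := by
    simp only [hcor]
    have hqc : Continuous fun z : Jk × C0 h ℝ => P (q z.1 z.2) :=
      P.continuous.comp (hq.comp_continuous
        ((continuous_subtype_val.comp continuous_fst).prodMk continuous_snd)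
        fun z => ⟨z.1.2, mem_univ _⟩)
    have hMc : Continuous fun z : Jk × C0 h ℝ => M z.1 := continuous_matrix fun i m =>
      (continuous_apply i).comp (P.continuous.comp (hq.comp_continuous
        ((continuous_subtype_val.comp continuous_fst).prodMk continuous_const)
        fun z => ⟨z.1.2, mem_univ _⟩))
    refine continuous_finsetSum _ fun m _ => Continuous.fun_smul ?_ continuous_const
    exact (hMc.matrix_det.inv₀ fun z => (hb z.1 z.1.2).2).mul
      (hMc.matrix_updateCol m hqc).matrix_det
  obtain ⟨K, hK, hKb⟩ := exists_bound_of_compact cor hcorc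
  refine ⟨fun r φ => φ - ∑ m, c r φ.toC0 m • b m, 1 + K, by positivity, ?_, ?_⟩
  · refine contDiffOn_snd.sub ?_
    have hMd : ∀ i m, ContDiffOn ℝ 1 (fun z : Rn k × C1 h ℝ => M z.1 i m) (Ik ×ˢ univ) := by
      intro i m
      have h1 : ContDiffOn ℝ 1 (fun z : Rn k × C1 h ℝ => q z.1 (b m).toC0) (Ik ×ˢ univ) :=
        ContDiffOn.comp (f := fun z : Rn k × C1 h ℝ => (z.1, b m)) hd
          (contDiffOn_fst.prodMk contDiffOn_const) fun z hz => ⟨hz.1, mem_univ _⟩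
      exact contDiffOn_pi.1 (P.contDiff.comp_contDiffOn h1) i
    have hqd : ∀ i, ContDiffOn ℝ 1 (fun z : Rn k × C1 h ℝ => P (q z.1 z.2.toC0) i) (Ik ×ˢ univ) :=
      contDiffOn_pi.1 (P.contDiff.comp_contDiffOn hd)
    have hcd : ∀ m, ContDiffOn ℝ 1 (fun z : Rn k × C1 h ℝ => c z.1 z.2.toC0 m) (Ik ×ˢ univ) := by
      intro m
      refine ContDiffOn.mul ((ContDiffOn.matrix_det hMd).inv fun z hz => (hb z.1 (hI hz.1)).2)
        (ContDiffOn.matrix_det fun i j => ?_)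
      simp only [Matrix.updateCol_apply]
      split_ifs
      exacts [hqd i, hMd i j]
    exact ContDiffOn.sum fun m _ => (hcd m).fun_smul contDiffOn_const
  · intro r hr
    have hr' := hI hr
    refine ⟨⟨fun φ ψ => ?_, fun a φ => ?_⟩, fun φ => ?_⟩
    · have h1 : c r (φ + ψ).toC0 = c r φ.toC0 + c r ψ.toC0 := (hclin r hr').map_add _ _
      simp only [h1, Pi.add_apply, add_smul, Finset.sum_add_distrib]
      abel
    · have h1 : c r (a • φ).toC0 = a • c r φ.toC0 := (hclin r hr').map_smul _ _
      simp only [h1, Pi.smul_apply, smul_eq_mul, mul_smul, smul_sub, Finset.smul_sum]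
    · have h0 : (φ - ∑ m, c r φ.toC0 m • b m).toC0 = φ.toC0 - ∑ m, c r φ.toC0 m • (b m).toC0 := by
        simp only [← C1.toC0L_apply, map_sub, map_sum, map_smul]
      have h1 : (φ - ∑ m, c r φ.toC0 m • b m).deriv =
          φ.deriv - ∑ m, c r φ.toC0 m • (b m).deriv := by
        simp only [← C1.derivL_apply, map_sub, map_sum, map_smul]
      refine ⟨?_, ?_, ?_⟩
      · refine (hb r hr').1 _ ?_
        have h2 : q r (φ.toC0 - ∑ m, c r φ.toC0 m • (b m).toC0) =
            q r φ.toC0 - ∑ m, c r φ.toC0 m • q r (b m).toC0 := by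
          change (hlin r hr').mk' (q r) _ = (hlin r hr').mk' (q r) _ -
            ∑ m, c r φ.toC0 m • (hlin r hr').mk' (q r) _
          simp only [map_sub, map_sum, map_smul]
        rw [h0, h2]
        simp only [map_sub, map_sum, map_smul]
        rw [hcq r hr', sub_self]
      · rw [h1]
        simp [ContinuousMap.sum_apply, hb0]
      · rw [h0, ← hcor ⟨r, hr'⟩, add_mul, one_mul]
        exact (norm_sub_le _ _).trans (add_le_add le_rfl (hKb _ _))

end KernelProjection

theorem isCompact_cube {k : ℕ} {K : Set ℝ} (hK : IsCompact K) : IsCompact (cube k K) := by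
  have h1 : IsCompact (univ.pi fun _ : Fin k => K) := isCompact_univ_pi fun _ => hK
  have h2 := h1.image (PiLp.continuous_toLp 2 fun _ : Fin k => ℝ)
  convert h2 using 1
  ext r
  constructor
  · exact fun hr => ⟨fun κ => r κ, fun κ _ => hr κ, rfl⟩
  · rintro ⟨x, hx, rfl⟩ κ
    exact hx κ (mem_univ κ)

/-! ### Existence of admissible maps -/

namespace DelaySystem

variable {h : ℝ} [Fact (0 < h)] {k n : ℕ} {F : Type*} [NormedAddCommGroup F] [NormedSpace ℝ F]
  (sys : DelaySystem h k n F)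

theorem continuousOn_iSup_abs {X ι : Type*} [TopologicalSpace X] [Finite ι] [Nonempty ι]
    {s : Set X} {f : ι → X → ℝ} (hf : ∀ i, ContinuousOn (f i) s) :
    ContinuousOn (fun x => ⨆ i, |f i x|) s := by
  have := Fintype.ofFinite ι
  simp only [← Finset.sup'_univ_eq_ciSup]
  exact ContinuousOn.finset_sup'_apply _ fun i _ => (hf i).abs

theorem continuous_hgNum : Continuous sys.hgNum := by
  unfold hgNum
  split_ifs
  · exact continuous_const
  · exact continuous_const.min (Metric.continuous_infDist_pt _)

theorem continuousOn_hg (hk : 1 ≤ k) (hn : 1 ≤ n) : ContinuousOn sys.hg sys.V := by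
  have : NeZero k := ⟨by omega⟩
  have : NeZero n := ⟨by omega⟩
  have hk' : (0 : ℝ) < k := by exact_mod_cast hk
  have hn' : (0 : ℝ) < n := by exact_mod_cast hn
  have hD : ContinuousOn sys.hgDen sys.V := by
    refine (continuousOn_const.add (continuousOn_iSup_abs fun p => ?_)).add
      (continuousOn_iSup_abs fun j => ?_)
    · have h1 := sys.contDiffOn_g.continuousOn_fderiv_of_isOpen sys.isOpen_V le_rfl
      exact (EuclideanSpace.proj p.2 : Rn n →L[ℝ] ℝ).continuous.comp_continuousOn
        (h1.clm_apply continuousOn_const)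
    · exact (EuclideanSpace.proj j : Rn n →L[ℝ] ℝ).continuous.comp_continuousOn
        sys.contDiffOn_g.continuousOn
  refine ContinuousOn.div (f := sys.hgNum) sys.continuous_hgNum.continuousOn
    (continuousOn_const.mul hD) fun v _ => ?_
  have := sys.one_le_hgDen v
  positivity

/-- The map `(r, v) ↦ p (r, ξ(1 / s(v)))` built from a kernel projection `p`, the curve
`ξ(l)(t) = t e ^ (l t)` in `C¹`, and a small positive function `s`. -/
theorem exists_admissible_component [FiniteDimensional ℝ F] (hk : 1 ≤ k) (hn : 1 ≤ n)
    (j : Fin n) : ∃ χ : Rn k → Rkn k n → C1 h ℝ,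
      ContDiffOn ℝ 1 (fun p : Rn k × Rkn k n => χ p.1 p.2) (sys.Ik ×ˢ sys.V) ∧
      ∀ r ∈ sys.Ik, ∀ v ∈ sys.V, sys.Q r ((χ r v).toC0.mulUnit j) = 0 ∧
        (χ r v).deriv ptR = 1 ∧ ‖(χ r v).toC0‖ ≤ sys.hg v ∧
        ∀ ν : Fin k × Fin n,
          ‖(fderiv ℝ (fun w => χ r w) v (EuclideanSpace.single ν 1)).toC0‖ ≤ sys.hg v := by
  have hmul : ∀ φ : C0 h ℝ, φ.mulUnit j = C0.mapL (unitMap j) φ := fun _ => rfl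
  obtain ⟨p, K, hK, hp, hpr⟩ := (sys.condHq j).exists_kernel_projection (Ik := sys.Ik)
    (isCompact_cube isCompact_Icc) sys.Ik_subset
    (sys.continuousOn_Q.comp (f := fun z : Rn k × C0 h ℝ => (z.1, C0.mapL (unitMap j) z.2))
      (continuous_fst.prodMk ((C0.mapL (unitMap j)).continuous.comp continuous_snd)).continuousOn
      fun z hz => ⟨hz.1, mem_univ _⟩)
    (fun r hr => by
      have hl := sys.isLinearMap_Q r hr
      exact ((hl.mk' (sys.Q r)).comp (C0.mapL (unitMap j)).toLinearMap).isLinear)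
    (ContDiffOn.comp (f := fun z : Rn k × C1 h ℝ => (z.1, C1.mapL (unitMap j) z.2))
      sys.contDiffOn_Q
      (contDiff_fst.prodMk ((C1.mapL (unitMap j)).contDiff.comp contDiff_snd)).contDiffOn
      fun z hz => ⟨hz.1, mem_univ _⟩)
  -- The `2` comes from the bound `2/l²` for `t² e^(lt)` and `K` from the projection; the `1` keeps
  -- the divisor positive when `K = 0`.
  have hpos : 0 < 2 * K + 1 := by positivity
  obtain ⟨s, hs, hsV⟩ := exists_contDiff_pos_le sys.isOpen_V
    ((sys.continuousOn_hg hk hn).div_const (2 * K + 1))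
    fun v hv => div_pos (sys.hg_pos hk hn hv) hpos
  have hbound : ∀ v ∈ sys.V, ∀ x, 0 ≤ x → x ≤ sys.hg v / (2 * K + 1) →
      K * (2 * x) ≤ sys.hg v := by
    intro v hv x hx0 hx
    rw [le_div_iff₀ hpos] at hx
    nlinarith
  have hsi : ContDiffOn ℝ 1 (fun v => (s v)⁻¹) sys.V :=
    hs.contDiffOn.inv fun v hv => (hsV v hv).1.ne'
  refine ⟨fun r v => p r (expPow1 1 (s v)⁻¹), ?_, fun r hr v hv => ?_⟩
  · have h1 : ContDiffOn ℝ 1 (fun v => expPow1 (h := h) 1 (s v)⁻¹) sys.V :=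
      (contDiff_expPow1 1).comp_contDiffOn hsi
    have h2 : ContDiffOn ℝ 1 (fun z : Rn k × Rkn k n => expPow1 (h := h) 1 (s z.2)⁻¹)
        (sys.Ik ×ˢ sys.V) := h1.comp contDiffOn_snd fun z hz => hz.2
    exact ContDiffOn.comp (f := fun z : Rn k × Rkn k n => (z.1, expPow1 (h := h) 1 (s z.2)⁻¹))
      hp (contDiffOn_fst.prodMk h2) fun z hz => ⟨hz.1, mem_univ _⟩
  · obtain ⟨hlin, hφ⟩ := hpr r hr
    obtain ⟨hs0, hsle, hsd⟩ := hsV v hv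
    have hl : 0 < (s v)⁻¹ := inv_pos.2 hs0
    refine ⟨(hφ _).1, (hφ _).2.1.trans (expPow1_one_deriv_ptR _), ?_, fun ν => ?_⟩
    · refine (hφ _).2.2.trans ?_
      have h1 := norm_expPow_one_le (h := h) hl
      rw [inv_inv] at h1
      refine le_trans (mul_le_mul_of_nonneg_left ?_ hK) (hbound v hv _ hs0.le hsle)
      rw [expPow1_toC0]; linarith
    · have hpc : Continuous (p r) :=
        hp.continuousOn.comp_continuous (f := fun φ : C1 h ℝ => (r, φ))
          (continuous_const.prodMk continuous_id) fun φ => ⟨hr, mem_univ _⟩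
      let L : C1 h ℝ →L[ℝ] C1 h ℝ := ⟨hlin.mk' (p r), hpc⟩
      have h1 : HasFDerivAt (fun w => (s w)⁻¹) (-(s v ^ 2)⁻¹ • fderiv ℝ s v) v :=
        (hasDerivAt_inv hs0.ne').comp_hasFDerivAt v
          (hs.differentiable one_ne_zero v).hasFDerivAt
      have h2 := (hasDerivAt_expPow1 (h := h) 1 (s v)⁻¹).hasFDerivAt.comp v h1
      have h3 : HasFDerivAt (fun w => p r (expPow1 1 (s w)⁻¹)) _ v :=
        L.hasFDerivAt.comp v h2
      rw [h3.fderiv]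
      set e := fderiv ℝ s v (EuclideanSpace.single ν 1) with he
      have h4 : ‖e‖ ≤ ‖fderiv ℝ s v‖ := by
        have := (fderiv ℝ s v).le_opNorm (EuclideanSpace.single ν 1)
        simpa using this
      -- The derivative is the projection of this multiple of `t² e^(lt)`; its factor `s⁻²` cancels
      -- against the bound `2 s²`, leaving `2 ‖Ds‖`.
      have h5 := (hφ ((-(s v ^ 2)⁻¹ * e) • expPow1 2 (s v)⁻¹)).2.2
      refine le_trans h5 (le_trans (mul_le_mul_of_nonneg_left ?_ hK)
        (hbound v hv _ (norm_nonneg _) hsd))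
      have h6 : ((-(s v ^ 2)⁻¹ * e) • expPow1 (h := h) 2 (s v)⁻¹).toC0 =
        (-(s v ^ 2)⁻¹ * e) • expPow 2 (s v)⁻¹ := rfl
      have h7 := norm_expPow_two_le (h := h) hl
      rw [inv_inv] at h7
      rw [h6, norm_smul, norm_mul, norm_neg, norm_inv, Real.norm_of_nonneg (sq_nonneg _)]
      calc (s v ^ 2)⁻¹ * ‖e‖ * ‖expPow (h := h) 2 (s v)⁻¹‖
          ≤ (s v ^ 2)⁻¹ * ‖fderiv ℝ s v‖ * (2 * s v ^ 2) := by gcongr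
        _ = 2 * ‖fderiv ℝ s v‖ := by field_simp

theorem exists_isAdmissible [FiniteDimensional ℝ F] (hk : 1 ≤ k) (hn : 1 ≤ n) :
    ∃ χ, sys.IsAdmissible χ := by
  choose χ hd hχ using sys.exists_admissible_component hk hn
  exact ⟨χ, hd, fun j r hr v hv => (hχ j r hr v hv).1, fun j r hr v hv => (hχ j r hr v hv).2.1,
    fun j r hr v hv => (hχ j r hr v hv).2.2.1, fun j r hr v hv => (hχ j r hr v hv).2.2.2⟩

end DelaySystem

end

end AlgDelay

/-- Maps `χ_{g,1}, …, χ_{g,n}` as required exist, and for every choice of them the resulting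
map `T` is a `C¹` diffeomorphism of the open set `𝒰` onto the open set `𝒪`, with inverse `Y`. -/
theorem proposition4p3 (h : ℝ) [Fact (0 < h)] (k n : ℕ) (hk : 1 ≤ k) (hn : 1 ≤ n)
    (F : Type*) [NormedAddCommGroup F] [NormedSpace ℝ F] [FiniteDimensional ℝ F]
    (sys : AlgDelay.DelaySystem h k n F) :
    (∃ χ, sys.IsAdmissible χ) ∧
    ∀ χ, sys.IsAdmissible χ →
      IsOpen sys.U ∧ IsOpen (sys.O χ) ∧
      (∀ r ∈ sys.Ik, Set.InjOn (sys.S χ r) sys.V) ∧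
      ContDiffOn ℝ 1 (sys.T χ) sys.U ∧ ContDiffOn ℝ 1 (sys.Y χ) (sys.O χ) ∧
      (∀ p ∈ sys.O χ, sys.Q (sys.Y χ p).1 (sys.Y χ p).2.toC0 = sys.Q p.1 p.2.toC0) ∧
      (Set.MapsTo (sys.T χ) sys.U (sys.O χ) ∧ ∀ p ∈ sys.U, sys.Y χ (sys.T χ p) = p) ∧
      (Set.MapsTo (sys.Y χ) (sys.O χ) sys.U ∧ ∀ p ∈ sys.O χ, sys.T χ (sys.Y χ p) = p) ∧
      Set.BijOn (sys.T χ) sys.U (sys.O χ) := by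
  refine ⟨sys.exists_isAdmissible hk hn, fun χ hχ => ⟨sys.isOpen_U, hχ.isOpen_O hk hn,
    fun r hr => hχ.injOn_S hk hn hr, hχ.contDiffOn_T, hχ.contDiffOn_Y hk hn,
    fun p hp => hχ.Q_B hp, ⟨hχ.mapsTo_T, fun p hp => hχ.Y_T hk hn hp⟩,
    ⟨hχ.mapsTo_Y, fun p hp => AlgDelay.DelaySystem.T_Y hp⟩, ?_⟩⟩
  have hinv : Set.InvOn (sys.Y χ) (sys.T χ) sys.U (sys.O χ) :=
    ⟨fun p hp => hχ.Y_T hk hn hp, fun p hp => AlgDelay.DelaySystem.T_Y hp⟩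
  exact hinv.bijOn hχ.mapsTo_T hχ.mapsTo_Y
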